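/- **Setting.** Logarithms are to base 2, $\log s:=-\infty$ for $s\le 0$, and $0\cdot(-\infty):=0$. Let $\mathcal X,\mathcal Y$ be finite input sets, $\mathcal A_x,\mathcal B_y$ ($x\in\mathcal X,y\in\mathcal Y$) subsets of output alphabets (that of Alice finite, all $\mathcal B_y$ finite), $\mathcal X_K,\mathcal X_T\subseteq\mathcal X$, $\mathcal Y_K,\mathcal Y_T\subseteq\mathcal Y$. In a round a test bit $T$ is drawn with $\mathrm P(T=1)=\gamma\in[0,1)$; if $T=0$ the inputs $(X,Y)$ are drawn from a fixed distribution on $\mathcal X_K\times\mathcal Y_K$, if $T=1$ from a fixed distribution on $\mathcal X_T\times\mathcal Y_T$. The test datum is $\bar C=f(a,b,x,y,t)$ with values in a finite set $\mathcal C\cup\{\perp\}$; it is $\perp$ if $t=0$ and lies in $\mathcal C$ if $t=1$. For POVMs $\{M_{a|x}\}_{a\in\mathcal A_x}$ on $Q_A$, $\{N_{b|y}\}_{b\in\mathcal B_y}$ on $Q_B$ and a normalised state $\sigma$ on $Q_A\otimes Q_B\otimes E$ (finite-dimensional systems) let $$\mathcal M(\sigma)=\sum_{x,y,t}\mathrm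 P(x,y,t)\sum_{a,b}|a,\bar c,x,y,t\rangle\langle a,\bar c,x,y,t|\otimes\mathrm{Tr}_{Q_AQ_B}\big[(M_{a|x}\otimes N_{b|y}\otimes 1)\sigma\big],\qquad \bar c=f(a,b,x,y,t),$$ let $\mathcal M(\sigma)_{\bar C}$ be the distribution of $\bar C$, and let $H_\alpha(A|T=0,XE)_{\mathcal M(\sigma)}$ be the Petz–Rényi conditional entropy $H_\alpha(A|B)_\rho=-D_\alpha(\rho_{AB}\|1_A\otimes\rho_B)$ of the state conditioned on $T=0$ and reduced to $A$ and $B=XE$, where $D_\alpha(\rho\|\sigma)=\frac1{\alpha-1}\log\frac{\mathrm{Tr}[\rho^\alpha\sigma^{1-\alpha}]}{\mathrm{Tr}\rho}$ for $\alpha>1$ if $\ker\sigma\subseteq\ker\rho$, and $+\infty$ otherwise. Let $D(q\|p)=\sum_{\bar c}q(\bar c)\log\frac{q(\bar c)}{p(\bar c)}$, where a summand is $0$ if $q(\bar c)=0\le p(\bar c)$ and $+\infty$ if $q(\bar c)>0\ge p(\bar c)$ or $p(\bar c)<0$ ($p$ need not be normalised). Let $S_\Omega$ be any set of probability distributions on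 $\mathcal C\cup\{\perp\}$ and $q_{\min}(\perp)=\inf_{q\in S_\Omega}q(\perp)$. **Quadrature.** Let $m\ge1$ and $\alpha\in(1,2)$. Let $t_1<\dots<t_m=1$ and $w_1,\dots,w_m$ be nodes and weights of the $m$-point Gauss–Radau–Jacobi quadrature, i.e. $\int_0^1p(s)s^{\alpha-1}(1-s)^{1-\alpha}ds=\sum_iw_ip(t_i)$ for all real polynomials $p$ of degree at most $2m-2$. **NPA relaxation.** Consider noncommuting variables $M_{a|x}=M_{a|x}^\dagger$, $N_{b|y}=N_{b|y}^\dagger$ and $Z_{a,i}^x,Z_{a,i}^{x\dagger}$ ($x\in\mathcal X_K$, $a\in\mathcal A_x$, $1\le i\le m$), the polynomials $$p_{\bar c}=\sum_{a,b,x,y,t:\,f(a,b,x,y,t)=\bar c}\mathrm P(x,y,t)M_{a|x}N_{b|y},\qquad G=\sum_{x\in\mathcal X_K}\mathrm P(x|T=0)\sum_{a\in\mathcal A_x}\big(M_{a|x}P_{a,x}+Q_{a,x}\big),$$ $$P_{a,x}=1+\tfrac{\sin(\alpha\pi)}{\pi}\sum_i\tfrac{w_i}{t_i}\big(1+Z^x_{a,i}+Z^{x\dagger}_{a,i}+(1-t_i)Z^{x\dagger}_{a,i}Z^x_{a,i}\big),\qquad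 Q_{a,x}=\tfrac{\sin(\alpha\pi)}{\pi}\sum_iw_iZ^x_{a,i}Z^{x\dagger}_{a,i},$$ and the constraints $M_{a|x}\succeq0$, $N_{b|y}\succeq0$, $\sum_aM_{a|x}-1=0$, $\sum_bN_{b|y}-1=0$, $[M_{a|x},N_{b|y}]=0$, $[M_{a|x},Z]=[N_{b|y},Z]=0$ for $Z$ any $Z^{x'}_{a',i}$ or $Z^{x'\dagger}_{a',i}$, and, optionally, $M_{a|x}^2=M_{a|x}$, $N_{b|y}^2=N_{b|y}$; every equation $r=0$ is read as the two constraints $r\succeq0$, $-r\succeq0$. An NPA relaxation consists of finite sets $\mathcal S_k$ of monomials, one for each constraint $k_0:=1\succeq0$ (giving the moment matrix) and each constraint $k\succeq0$ in the list (an empty set means that the constraint is not used), and a finite set $W\ni1$ of monomials containing all monomials of all $p_{\bar c}$, of $G$, and of $u^\dagger kv$ for $u,v\in\mathcal S_k$. It has one real variable $y_u$ for each $u\in W$ (so $N=|W|$). For a polynomial $p=\sum_up_uu$ put $L_y(p)=\sum_{u\in W}p_uy_u$. The relaxation generates the linear functions $f_{\bar c}(y)=L_y(p_{\bar c})$ and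 $g(y)=L_y(G)$ and the block-diagonal matrix $M(y)$ with blocks $\big(L_y(u^\dagger kv)\big)_{u,v\in\mathcal S_k}$, whose entries are linear in $y$. **Theorem.** For all $\alpha\in(1,2)$ and $m\ge1$ the quadrature above exists, and its nodes and weights satisfy $t_i\in(0,1]$, $w_i>0$. For every NPA relaxation formed with such $t_i$, $w_i$, the quantity $$\inf_{\{M_{a|x}\},\{N_{b|y}\}}\ \inf_{q\in S_\Omega}\ \inf_{\sigma\in S_=(Q_AQ_BE)}\ \tfrac1{\alpha-1}D\big(q\,\|\,\mathcal M(\sigma)_{\bar C}\big)+q_{\min}(\perp)\,H_\alpha(A|T=0,XE)_{\mathcal M(\sigma)},$$ where the infimum is over devices and normalised states of all finite dimensions, is bounded from below by $$\inf_{q,\,y}\ \tfrac1{\alpha-1}D\big(q\,\|\,f(y)\big)+\tfrac{q_{\min}(\perp)}{1-\alpha}\log g(y)\quad\text{s.t.}\quad y_1=1,\ M(y)\succeq0,\ q\in S_\Omega,$$ where $y_1$ is the variable of the monomial $1$. If $S_\Omega$ is convex, the latter is a convex optimization problem (convex feasible set and convex extended-real-valued objective). -/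

import Mathlib

open scoped Kronecker ComplexOrder

noncomputable section

/-! ### Entropies of finite-dimensional states (all logarithms are to base two) -/

/-- The base-two logarithm as an extended-real concave function: `-∞` outside `(0, ∞)`. -/
def elogTwo (s : ℝ) : EReal :=
  if 0 < s then ((Real.logb 2 s : ℝ) : EReal) else ⊥

/-- One summand `q log (q / p)` of the relative entropy, with its usual extended values:
`0` if `q = 0 ≤ p`, and `+∞` if `q > 0` and `p ≤ 0` (or if an argument is negative). -/
def relEntropyTerm (q p : ℝ) : EReal :=
  if 0 < q ∧ 0 < p then ((q * Real.logb 2 (q / p) : ℝ) : EReal)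
  else if q = 0 ∧ 0 ≤ p then 0
  else ⊤

/-- The classical relative entropy `D(q ‖ p) = ∑ c, q c * log (q c / p c)`. The second argument
need not be normalised. -/
def relEntropy {ι : Type*} [Fintype ι] (q p : ι → ℝ) : EReal :=
  ∑ c, relEntropyTerm (q c) (p c)

/-- Real powers of a positive semidefinite matrix, through its spectral decomposition. A zero
eigenvalue stays zero for every nonzero exponent (powers on the support, pseudo-inverse). -/
def matPow {n : Type*} [Fintype n] [DecidableEq n] (ρ : Matrix n n ℂ) (s : ℝ) : Matrix n n ℂ :=
  cfc (fun u : ℝ => u ^ s) ρ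

open scoped Classical in
/-- The Petz-Rényi divergence `D_α(ρ ‖ σ)` of positive semidefinite matrices. -/
def petzDivergence {n : Type*} [Fintype n] [DecidableEq n] (α : ℝ) (ρ σ : Matrix n n ℂ) : EReal :=
  if (α < 1 ∧ ¬ (ρ * σ = 0 ∧ σ * ρ = 0)) ∨
      (∀ v : n → ℂ, Matrix.mulVec σ v = 0 → Matrix.mulVec ρ v = 0) then
    ((1 / (α - 1) *
      Real.logb 2 ((matPow ρ α * matPow σ (1 - α)).trace.re / ρ.trace.re) : ℝ) : EReal)
  else ⊤

/-- The reduced state on the second factor. -/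
def reduceRight {n k : Type*} [Fintype n] (ρ : Matrix (n × k) (n × k) ℂ) : Matrix k k ℂ :=
  fun e e' => ∑ i, ρ (i, e) (i, e')

/-- The Petz-Rényi conditional entropy `H_α(A|B)_ρ = - D_α(ρ_{AB} ‖ 1_A ⊗ ρ_B)`. -/
def petzCondEntropy {n k : Type*} [Fintype n] [DecidableEq n] [Fintype k] [DecidableEq k]
    (α : ℝ) (ρ : Matrix (n × k) (n × k) ℂ) : EReal :=
  - petzDivergence α ρ ((1 : Matrix n n ℂ) ⊗ₖ reduceRight ρ)

/-! ### The protocol, the devices and the single-round map -/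

/-- The public data of one round. `X`, `Y` are the input alphabets, `A`, `B` contain all outputs,
`outA x`, `outB y` are the outputs possible on the given input. The test bit is `true` (a test
round) with probability `γ`; key rounds and test rounds have their own input distributions. In
test rounds the recorded datum is `testFn a b x y`. -/
structure Protocol (X Y A B C : Type*) [Fintype X] [Fintype Y] where
  keyX : Finset X
  keyY : Finset Y
  testX : Finset X
  testY : Finset Y
  outA : X → Finset A
  outB : Y → Finset B
  γ : ℝ
  γ_nonneg : 0 ≤ γ
  γ_lt_one : γ < 1
  keyDist : X × Y → ℝ
  keyDist_mem : keyDist ∈ stdSimplex ℝ (X × Y)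
  keyDist_support : ∀ x y, keyDist (x, y) ≠ 0 → x ∈ keyX ∧ y ∈ keyY
  testDist : X × Y → ℝ
  testDist_mem : testDist ∈ stdSimplex ℝ (X × Y)
  testDist_support : ∀ x y, testDist (x, y) ≠ 0 → x ∈ testX ∧ y ∈ testY
  testFn : A → B → X → Y → C

namespace Protocol

variable {X Y A B C : Type*} [Fintype X] [Fintype Y] (P : Protocol X Y A B C)

/-- `P(X = x, Y = y, T = t)`. -/
def inputProb (x : X) (y : Y) (t : Bool) : ℝ :=
  if t = true then P.γ * P.testDist (x, y) else (1 - P.γ) * P.keyDist (x, y)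

/-- `P(X = x | T = 0)`. -/
def keyProb (x : X) : ℝ := ∑ y, P.keyDist (x, y)

/-- The test data of a round; `none` is the symbol `⊥` of a key-generating round. -/
def testData (a : A) (b : B) (x : X) (y : Y) (t : Bool) : Option C :=
  if t = true then some (P.testFn a b x y) else none

/-- The measurements of Alice and Bob: a POVM for every input, on systems of dimensions
`dA` and `dB`. -/
structure Device (dA dB : ℕ) where
  M : (x : X) → P.outA x → Matrix (Fin dA) (Fin dA) ℂ
  N : (y : Y) → P.outB y → Matrix (Fin dB) (Fin dB) ℂ
  M_pos : ∀ x a, (M x a).PosSemidef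
  N_pos : ∀ y b, (N y b).PosSemidef
  M_sum : ∀ x, ∑ a, M x a = 1
  N_sum : ∀ y, ∑ b, N y b = 1

end Protocol

/-- The normalised states on `Q_A ⊗ Q_B ⊗ E`. -/
def NormalizedState (dA dB dE : ℕ) : Type :=
  {σ : Matrix (Fin dA × Fin dB × Fin dE) (Fin dA × Fin dB × Fin dE) ℂ //
    σ.PosSemidef ∧ σ.trace = 1}

/-- The partial trace over `Q_A Q_B`. -/
def traceOutAB {dA dB dE : ℕ}
    (τ : Matrix (Fin dA × Fin dB × Fin dE) (Fin dA × Fin dB × Fin dE) ℂ) :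
    Matrix (Fin dE) (Fin dE) ℂ :=
  fun e e' => ∑ i, ∑ j, τ (i, j, e) (i, j, e')

/-- The classical registers `A`, `C`, `X`, `Y`, `T` of the output of a round. -/
abbrev ClassicalReg (X Y A C : Type*) := A × Option C × X × Y × Bool

namespace Protocol

variable {X Y A B C : Type*} [Fintype X] [DecidableEq X] [Fintype Y] [DecidableEq Y]
  [Fintype A] [DecidableEq A] [Fintype C] [DecidableEq C]

/-- The output state of the single-round map on the classical registers and `E`:
`∑ P(x,y,t) |a,c,x,y,t⟩⟨a,c,x,y,t| ⊗ Tr_{Q_A Q_B} [(M_{a|x} ⊗ N_{b|y} ⊗ 1) σ]`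
with `c = f(a,b,x,y,t)`. -/
def roundOutput (P : Protocol X Y A B C) {dA dB dE : ℕ} (𝒟 : P.Device dA dB)
    (σ : NormalizedState dA dB dE) :
    Matrix (ClassicalReg X Y A C × Fin dE) (ClassicalReg X Y A C × Fin dE) ℂ :=
  ∑ x : X, ∑ y : Y, ∑ t : Bool, ∑ a : P.outA x, ∑ b : P.outB y,
    (P.inputProb x y t : ℂ) •
      (Matrix.single (a.1, P.testData a.1 b.1 x y t, x, y, t)
          (a.1, P.testData a.1 b.1 x y t, x, y, t) (1 : ℂ) ⊗ₖ
        traceOutAB ((𝒟.M x a ⊗ₖ (𝒟.N y b ⊗ₖ (1 : Matrix (Fin dE) (Fin dE) ℂ))) * σ.1))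

end Protocol

section Registers

variable {X Y A C : Type*} [Fintype X] [Fintype Y] [Fintype A] [Fintype C] {dE : ℕ}

/-- The classical distribution of the test-data register. -/
def testDataDist
    (ρ : Matrix (ClassicalReg X Y A C × Fin dE) (ClassicalReg X Y A C × Fin dE) ℂ)
    (c : Option C) : ℝ :=
  ∑ a : A, ∑ x : X, ∑ y : Y, ∑ t : Bool, ∑ e : Fin dE,
    (ρ ((a, c, x, y, t), e) ((a, c, x, y, t), e)).re

/-- The partial state of the event `T = 0`. -/
def partialKey
    (ρ : Matrix (ClassicalReg X Y A C × Fin dE) (ClassicalReg X Y A C × Fin dE) ℂ) :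
    Matrix (ClassicalReg X Y A C × Fin dE) (ClassicalReg X Y A C × Fin dE) ℂ :=
  fun r s => if r.1.2.2.2.2 = false ∧ s.1.2.2.2.2 = false then ρ r s else 0

/-- The conditional state given `T = 0`. -/
def conditionKey
    (ρ : Matrix (ClassicalReg X Y A C × Fin dE) (ClassicalReg X Y A C × Fin dE) ℂ) :
    Matrix (ClassicalReg X Y A C × Fin dE) (ClassicalReg X Y A C × Fin dE) ℂ :=
  (ρ.trace / (partialKey ρ).trace) • partialKey ρ

/-- The reduced state on `A` and `X E`. -/
def reduceAXE
    (ρ : Matrix (ClassicalReg X Y A C × Fin dE) (ClassicalReg X Y A C × Fin dE) ℂ) :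
    Matrix (A × (X × Fin dE)) (A × (X × Fin dE)) ℂ :=
  fun r s => ∑ c : Option C, ∑ y : Y, ∑ t : Bool,
    ρ ((r.1, c, r.2.1, y, t), r.2.2) ((s.1, c, s.2.1, y, t), s.2.2)

/-- `H_α(A | T = 0, X E)`. -/
def keyEntropy [DecidableEq X] [DecidableEq A] (α : ℝ)
    (ρ : Matrix (ClassicalReg X Y A C × Fin dE) (ClassicalReg X Y A C × Fin dE) ℂ) : EReal :=
  petzCondEntropy α (reduceAXE (conditionKey ρ))

end Registers

/-- The least weight of `⊥` in the acceptance set. -/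
def qMin {C : Type*} (SΩ : Set (Option C → ℝ)) : ℝ :=
  sInf ((fun q : Option C → ℝ => q none) '' SΩ)

namespace Protocol

variable {X Y A B C : Type*} [Fintype X] [DecidableEq X] [Fintype Y] [DecidableEq Y]
  [Fintype A] [DecidableEq A] [Fintype C] [DecidableEq C]

/-- The simplified single-round objective, at a device, a distribution and a state. -/
def roundObjective (P : Protocol X Y A B C) (α : ℝ) (SΩ : Set (Option C → ℝ)) {dA dB dE : ℕ}
    (𝒟 : P.Device dA dB) (q : Option C → ℝ) (σ : NormalizedState dA dB dE) : EReal :=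
  ((1 / (α - 1) : ℝ) : EReal) * relEntropy q (testDataDist (P.roundOutput 𝒟 σ)) +
    ((qMin SΩ : ℝ) : EReal) * keyEntropy α (P.roundOutput 𝒟 σ)

/-- The infimum of the simplified objective over all devices (of all finite dimensions), all
accepted distributions and all normalised states. -/
def roundValue (P : Protocol X Y A B C) (α : ℝ) (SΩ : Set (Option C → ℝ)) : EReal :=
  ⨅ (dA : ℕ) (dB : ℕ) (dE : ℕ) (𝒟 : P.Device dA dB) (q ∈ SΩ) (σ : NormalizedState dA dB dE),
    P.roundObjective α SΩ 𝒟 q σ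

end Protocol

/-! ### The quadrature -/

/-- `t`, `w` are the nodes and weights of the `m`-point Gauss-Radau-Jacobi quadrature on `[0,1]`
with weight function `s^(α-1) (1-s)^(1-α)` and prescribed last node `1`: the rule is exact for
all polynomials of degree at most `2m - 2`. -/
structure IsGaussRadauJacobi (α : ℝ) {m : ℕ} (t w : Fin m → ℝ) : Prop where
  strictMono : StrictMono t
  last_eq_one : ∀ i : Fin m, (i : ℕ) + 1 = m → t i = 1
  exact_on : ∀ p : Polynomial ℝ, p.natDegree + 2 ≤ 2 * m →
    ∫ s in (0 : ℝ)..1, p.eval s * (s ^ (α - 1) * (1 - s) ^ (1 - α)) = ∑ i, w i * p.eval (t i)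

/-! ### Noncommutative polynomials and the NPA relaxation -/

section NPA

variable {X Y A B C : Type*} [Fintype X] [Fintype Y]

/-- The noncommuting variables: `M_{a|x}`, `N_{b|y}`, `Z_{a,i}^x` and its adjoint, the last two
for key inputs `x` only. -/
inductive Letter (P : Protocol X Y A B C) (m : ℕ) : Type _
  | alice (x : X) (a : P.outA x)
  | bob (y : Y) (b : P.outB y)
  | eve (x : P.keyX) (a : P.outA x.1) (i : Fin m)
  | eveAdj (x : P.keyX) (a : P.outA x.1) (i : Fin m)

variable {P : Protocol X Y A B C} {m : ℕ}

/-- The adjoint of a variable; `M_{a|x}` and `N_{b|y}` are self-adjoint. -/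
def Letter.adj : Letter P m → Letter P m
  | .alice x a => .alice x a
  | .bob y b => .bob y b
  | .eve x a i => .eveAdj x a i
  | .eveAdj x a i => .eve x a i

variable (P m) in
/-- Monomials in the noncommuting variables. -/
abbrev NCWord := FreeMonoid (Letter P m)

variable (P m) in
/-- Polynomials with real coefficients in the noncommuting variables. -/
abbrev NCPoly := MonoidAlgebra ℝ (NCWord P m)

/-- The adjoint of a monomial. -/
def NCWord.adj (u : NCWord P m) : NCWord P m :=
  FreeMonoid.ofList ((FreeMonoid.toList u).map Letter.adj).reverse

/-- A monomial as a polynomial. -/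
def mono (u : NCWord P m) : NCPoly P m := MonoidAlgebra.of ℝ (NCWord P m) u

/-- A variable as a polynomial. -/
def ncVar (l : Letter P m) : NCPoly P m := mono (FreeMonoid.of l)

/-- The equations imposed on the variables. -/
inductive NPARelation (P : Protocol X Y A B C) (m : ℕ) : Type _
  | sumA (x : X)
  | sumB (y : Y)
  | commAB (x : X) (a : P.outA x) (y : Y) (b : P.outB y)
  | commAE (x : X) (a : P.outA x) (x' : P.keyX) (a' : P.outA x'.1) (i : Fin m)
  | commAEadj (x : X) (a : P.outA x) (x' : P.keyX) (a' : P.outA x'.1) (i : Fin m)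
  | commBE (y : Y) (b : P.outB y) (x' : P.keyX) (a' : P.outA x'.1) (i : Fin m)
  | commBEadj (y : Y) (b : P.outB y) (x' : P.keyX) (a' : P.outA x'.1) (i : Fin m)
  | projA (x : X) (a : P.outA x)
  | projB (y : Y) (b : P.outB y)

/-- The commutator of two variables. -/
def ncComm (k l : Letter P m) : NCPoly P m := ncVar k * ncVar l - ncVar l * ncVar k

/-- The polynomial whose vanishing is the given equation: completeness of the measurements,
commutation between the three parties, and projectivity of the measurements. -/
def NPARelation.poly : NPARelation P m → NCPoly P m
  | .sumA x => (∑ a, ncVar (.alice x a)) - 1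
  | .sumB y => (∑ b, ncVar (.bob y b)) - 1
  | .commAB x a y b => ncComm (.alice x a) (.bob y b)
  | .commAE x a x' a' i => ncComm (.alice x a) (.eve x' a' i)
  | .commAEadj x a x' a' i => ncComm (.alice x a) (.eveAdj x' a' i)
  | .commBE y b x' a' i => ncComm (.bob y b) (.eve x' a' i)
  | .commBEadj y b x' a' i => ncComm (.bob y b) (.eveAdj x' a' i)
  | .projA x a => ncVar (.alice x a) * ncVar (.alice x a) - ncVar (.alice x a)
  | .projB y b => ncVar (.bob y b) * ncVar (.bob y b) - ncVar (.bob y b)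

/-- The positivity constraints `q ⪰ 0`: the trivial one `q = 1` (which gives the moment matrix),
positivity of the measurement operators, and each equation as two opposite inequalities. -/
inductive NPAConstraint (P : Protocol X Y A B C) (m : ℕ) : Type _
  | unit
  | posA (x : X) (a : P.outA x)
  | posB (y : Y) (b : P.outB y)
  | eqNonneg (r : NPARelation P m)
  | eqNonpos (r : NPARelation P m)

/-- The polynomial that a constraint requires to be positive. -/
def NPAConstraint.poly : NPAConstraint P m → NCPoly P m
  | .unit => 1
  | .posA x a => ncVar (.alice x a)
  | .posB y b => ncVar (.bob y b)
  | .eqNonneg r => r.poly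
  | .eqNonpos r => - r.poly

/-- The polynomial
`P(Z_1, Z_2, …) = 1 + (sin(πα)/π) ∑ (w_i/t_i) (1 + Z_i + Z_i† + (1-t_i) Z_i† Z_i)`
in the variables attached to `x`, `a`. -/
def evePolyP (α : ℝ) (t w : Fin m → ℝ) (x : P.keyX) (a : P.outA x.1) : NCPoly P m :=
  1 + (Real.sin (α * Real.pi) / Real.pi) • ∑ i, (w i / t i) •
    (1 + ncVar (.eve x a i) + ncVar (.eveAdj x a i) +
      (1 - t i) • (ncVar (.eveAdj x a i) * ncVar (.eve x a i)))

/-- The polynomial `Q(Z_1, Z_2, …) = (sin(πα)/π) ∑ w_i Z_i Z_i†`. -/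
def evePolyQ (α : ℝ) (w : Fin m → ℝ) (x : P.keyX) (a : P.outA x.1) : NCPoly P m :=
  (Real.sin (α * Real.pi) / Real.pi) • ∑ i, w i • (ncVar (.eve x a i) * ncVar (.eveAdj x a i))

variable (P) in
/-- The polynomial for the entropy term:
`∑ x ∈ X_K, P(x | T = 0) ∑ a, (M_{a|x} P(Z) + Q(Z))`. -/
def entropyPoly (α : ℝ) (t w : Fin m → ℝ) : NCPoly P m :=
  ∑ x : P.keyX, P.keyProb x.1 • ∑ a : P.outA x.1,
    (ncVar (.alice x.1 a) * evePolyP α t w x a + evePolyQ α w x a)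

variable (P m) in
open scoped Classical in
/-- The polynomial for the probability of the test datum `c`:
`∑ P(x,y,t) M_{a|x} N_{b|y}` over all `a, b, x, y, t` with `f(a,b,x,y,t) = c`. -/
def testPoly (c : Option C) : NCPoly P m :=
  ∑ x : X, ∑ y : Y, ∑ s : Bool, ∑ a : P.outA x, ∑ b : P.outB y,
    if P.testData a.1 b.1 x y s = c then
      P.inputProb x y s • (ncVar (.alice x a) * ncVar (.bob y b))
    else 0

/-- An NPA relaxation: for every constraint a finite set `index j` of monomials that index the
rows and columns of its (moment or localizing) matrix, where an empty set means that the constraint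
is not used, and a finite set `words` of monomials that contains all monomials which then occur;
it carries one real variable for each of its members. -/
structure NPARelaxation (P : Protocol X Y A B C) (α : ℝ) (t w : Fin m → ℝ) where
  words : Finset (NCWord P m)
  index : NPAConstraint P m → Finset (NCWord P m)
  one_mem : 1 ∈ words
  entry_mem : ∀ j, ∀ u ∈ index j, ∀ v ∈ index j,
    (mono u.adj * j.poly * mono v).coeff.support ⊆ words
  test_mem : ∀ c, (testPoly P m c).coeff.support ⊆ words
  entropy_mem : (entropyPoly P α t w).coeff.support ⊆ words

namespace NPARelaxation

variable {α : ℝ} {t w : Fin m → ℝ} (R : NPARelaxation P α t w)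

/-- The linear function `∑ p_u y_u` of the variables `y` which replaces the polynomial `∑ p_u u`. -/
def lin (p : NCPoly P m) (y : R.words → ℝ) : ℝ := ∑ u : R.words, p.coeff u.1 * y u

/-- The linear function `f_c`. -/
def f (y : R.words → ℝ) (c : Option C) : ℝ := R.lin (testPoly P m c) y

/-- The linear function `g`. -/
def g (y : R.words → ℝ) : ℝ := R.lin (entropyPoly P α t w) y

open scoped Classical in
/-- The matrix `M(y)`: block diagonal, the block of the constraint `q ⪰ 0` having the
entries `∑ s, q_s y_{u† s v}`, for `u`, `v` in the index set of the constraint. -/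
def momentMatrix (y : R.words → ℝ) :
    Matrix (Σ j : NPAConstraint P m, R.index j) (Σ j : NPAConstraint P m, R.index j) ℝ :=
  Matrix.blockDiagonal' fun j : NPAConstraint P m =>
    Matrix.of fun u v : R.index j => R.lin (mono u.1.adj * j.poly * mono v.1) y

/-- The feasible set of the relaxed program. -/
def feasible (SΩ : Set (Option C → ℝ)) : Set ((Option C → ℝ) × (R.words → ℝ)) :=
  {z | z.1 ∈ SΩ ∧ z.2 ⟨1, R.one_mem⟩ = 1 ∧ (R.momentMatrix z.2).PosSemidef}

/-- The objective of the relaxed program. -/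
def objective [Fintype C] (SΩ : Set (Option C → ℝ)) (z : (Option C → ℝ) × (R.words → ℝ)) :
    EReal :=
  ((1 / (α - 1) : ℝ) : EReal) * relEntropy z.1 (R.f z.2) +
    ((qMin SΩ / (1 - α) : ℝ) : EReal) * elogTwo (R.g z.2)

/-- The optimal value of the relaxed program. -/
def value [Fintype C] (SΩ : Set (Option C → ℝ)) : EReal :=
  ⨅ z ∈ R.feasible SΩ, R.objective SΩ z

end NPARelaxation

end NPA

/-- The minimisation of `φ` over `F` is a convex optimization problem. -/
def IsConvexProgram {V : Type*} [AddCommGroup V] [Module ℝ V] (F : Set V) (φ : V → EReal) : Prop :=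
  Convex ℝ F ∧ ∀ u ∈ F, ∀ v ∈ F, ∀ a b : ℝ, 0 < a → 0 < b → a + b = 1 →
    φ (a • u + b • v) ≤ (a : EReal) * φ u + (b : EReal) * φ v

end

/-!
The free nodes of the Gauss-Radau rule are the zeros of the orthogonal polynomial for the weight
multiplied by `1 - s`. Besides polynomials of degree at most `2m - 2`, the rule is exact for a
polynomial interpolant of the kernel `(1 - x) / (x + (1 - x) s)` that stays on one side of it.
Inserted into the integral representation of `x ^ α`, and because `sin (α π) < 0`, this bounds
`x ^ α * y ^ (1 - α)` from above by a sum of rational functions of `x` and `y`, each of which is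
the minimum over `z` of a quadratic expression in `z`.

Spectral decompositions of `ρ` and `σ` turn the scalar bound into
`Tr[ρ^α σ^(1 - α)] ≤ Tr[ρ P(Z)] + Tr[σ Q(Z)]` for suitable matrices `Z`. As `P` and `Q` are concave
under compression, compressing `Z` to the register blocks `|a, x⟩` only increases the right-hand
side, which then involves nothing but Alice's unnormalised conditional states on `E`. After a
Naimark dilation the measurements are projective and commute with `Z`, so their moments in the state
`σ` form a feasible point of every relaxation, at which `f` is the distribution of the test datum
and `g` dominates the Petz trace. Convexity is the log-sum inequality together with the concavity of
`log`.
-/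

/-! ### Gauss-Radau quadrature -/

section GaussRadau

open Polynomial Set

/-- Positive functionals on polynomials: the abstract form of integration against a positive
weight on `S`, and all that the theory of Gauss-type quadratures needs to know about it. -/
def IsPositiveOn (L : ℝ[X] →ₗ[ℝ] ℝ) (S : Set ℝ) : Prop :=
  ∀ p : ℝ[X], p ≠ 0 → (∀ s ∈ S, 0 ≤ p.eval s) → 0 < L p

/-- The monic orthogonal polynomial of degree `n` for the form `(p, q) ↦ L (p * q)`. -/
structure IsMonicOrthogonal (L : ℝ[X] →ₗ[ℝ] ℝ) (n : ℕ) (p : ℝ[X]) : Prop where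
  monic : p.Monic
  natDegree_eq : p.natDegree = n
  orthogonal : ∀ r : ℝ[X], r.degree < n → L (p * r) = 0

/-- The `m`-point Gauss-Radau quadrature for the functional `L` with prescribed last node `b`. -/
structure IsGaussRadau (L : ℝ[X] →ₗ[ℝ] ℝ) (b : ℝ) {m : ℕ} (t w : Fin m → ℝ) : Prop where
  strictMono : StrictMono t
  last_eq : ∀ i : Fin m, (i : ℕ) + 1 = m → t i = b
  exact_on : ∀ p : ℝ[X], p.natDegree + 2 ≤ 2 * m → L p = ∑ i, w i * p.eval (t i)

variable {L : ℝ[X] →ₗ[ℝ] ℝ} {S : Set ℝ} {n : ℕ} {p : ℝ[X]} {a b : ℝ}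

lemma IsPositiveOn.comp_mulLeft (hL : IsPositiveOn L S) {g : ℝ[X]} (hg : g ≠ 0)
    (hgS : ∀ s ∈ S, 0 ≤ g.eval s) : IsPositiveOn (L ∘ₗ LinearMap.mulLeft ℝ g) S := by
  intro p hp hpS
  refine hL (g * p) (mul_ne_zero hg hp) fun s hs => ?_
  rw [eval_mul]
  exact mul_nonneg (hgS s hs) (hpS s hs)

lemma IsPositiveOn.exists_representative (hL : IsPositiveOn L S) (n : ℕ)
    (φ : Module.Dual ℝ (degreeLT ℝ n)) :
    ∃ r : degreeLT ℝ n, ∀ q : degreeLT ℝ n, L (r.1 * q.1) = φ q := by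
  let T : degreeLT ℝ n →ₗ[ℝ] Module.Dual ℝ (degreeLT ℝ n) :=
    (LinearMap.mul ℝ ℝ[X]).compr₂ L |>.domRestrict₁₂ (degreeLT ℝ n) (degreeLT ℝ n)
  have : FiniteDimensional ℝ (degreeLT ℝ n) := Module.Finite.equiv (degreeLTEquiv ℝ n).symm
  have hinj : Function.Injective T := by
    rw [injective_iff_map_eq_zero]
    intro r hr
    by_contra hne
    have hr0 : r.1 ≠ 0 := fun h => hne (Subtype.ext h)
    have hsq : 0 < L (r.1 * r.1) := hL _ (mul_ne_zero hr0 hr0) fun s _ => by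
      rw [eval_mul]; exact mul_self_nonneg _
    exact hsq.ne' (LinearMap.congr_fun hr r)
  have hsurj : Function.Surjective T :=
    (LinearMap.injective_iff_surjective_of_finrank_eq_finrank
      Subspace.dual_finrank_eq.symm).1 hinj
  obtain ⟨r, hr⟩ := hsurj φ
  exact ⟨r, LinearMap.congr_fun hr⟩

lemma IsPositiveOn.exists_isMonicOrthogonal (hL : IsPositiveOn L S) (n : ℕ) :
    ∃ p, IsMonicOrthogonal L n p := by
  obtain ⟨r, hr⟩ := hL.exists_representative n
    (L ∘ₗ LinearMap.mulLeft ℝ (X ^ n) ∘ₗ (degreeLT ℝ n).subtype)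
  have hdeg : r.1.degree < (X ^ n : ℝ[X]).degree := by
    rw [degree_X_pow]; exact mem_degreeLT.1 r.2
  refine ⟨X ^ n - r.1, (monic_X_pow n).sub_of_left hdeg, ?_, fun q hq => ?_⟩
  · rw [natDegree_eq_of_degree_eq (degree_sub_eq_left_of_degree_lt hdeg), natDegree_X_pow]
  · rw [sub_mul, map_sub, sub_eq_zero]
    exact (hr ⟨q, mem_degreeLT.2 hq⟩).symm

namespace IsMonicOrthogonal

lemma exists_eval_neg_of_dvd (hp : IsMonicOrthogonal L n p) (hL : IsPositiveOn L S) {g : ℝ[X]}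
    (hg : g ∣ p) (hg1 : 1 ≤ g.natDegree) : ∃ s ∈ S, g.eval s < 0 := by
  by_contra! hcon
  obtain ⟨r, rfl⟩ := hg
  have hg0 : g ≠ 0 := left_ne_zero_of_mul hp.monic.ne_zero
  have hr0 : r ≠ 0 := right_ne_zero_of_mul hp.monic.ne_zero
  have hr : r.degree < n := by
    rw [← hp.natDegree_eq, natDegree_mul hg0 hr0, degree_eq_natDegree hr0]
    exact_mod_cast (by omega : r.natDegree < g.natDegree + r.natDegree)
  refine (hL _ (mul_ne_zero (mul_ne_zero hg0 hr0) hr0) fun s hs => ?_).ne' (hp.orthogonal r hr)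
  rw [mul_assoc, eval_mul, eval_mul]
  exact mul_nonneg (hcon s hs) (mul_self_nonneg _)

lemma exists_root_of_dvd (hp : IsMonicOrthogonal L n p) (hL : IsPositiveOn L S)
    (hS : IsPreconnected S) {g : ℝ[X]} (hg : g ∣ p) (hg1 : 1 ≤ g.natDegree) :
    ∃ s ∈ S, g.eval s = 0 := by
  obtain ⟨a, ha, hga⟩ := hp.exists_eval_neg_of_dvd hL hg hg1
  obtain ⟨b, hb, hgb⟩ := hp.exists_eval_neg_of_dvd hL (neg_dvd.2 hg) (by rwa [natDegree_neg])
  rw [eval_neg, neg_lt_zero] at hgb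
  exact hS.intermediate_value ha hb g.continuous.continuousOn ⟨hga.le, hgb.le⟩

lemma splits (hp : IsMonicOrthogonal L n p) (hL : IsPositiveOn L S) (hS : IsPreconnected S) :
    p.Splits := by
  obtain ⟨q, hq, hcard, hq0⟩ := exists_prod_multiset_X_sub_C_mul p
  have hqdeg : q.natDegree = 0 := by
    by_contra h
    obtain ⟨s, -, hs⟩ := hp.exists_root_of_dvd hL hS (Dvd.intro_left _ hq)
      (Nat.one_le_iff_ne_zero.2 h)
    have hmem : s ∈ q.roots := (mem_roots (ne_zero_of_natDegree_gt (Nat.pos_of_ne_zero h))).2 hs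
    rw [hq0] at hmem
    exact Multiset.notMem_zero s hmem
  exact splits_iff_card_roots.2 (by omega)

lemma nodup_roots (hp : IsMonicOrthogonal L n p) (hL : IsPositiveOn L S) : p.roots.Nodup := by
  rw [Multiset.nodup_iff_count_le_one]
  intro a
  rw [count_roots]
  by_contra! h
  obtain ⟨s, -, hs⟩ := hp.exists_eval_neg_of_dvd hL (g := (X - C a) ^ 2)
    ((le_rootMultiplicity_iff hp.monic.ne_zero).1 h) (by simp)
  rw [eval_pow] at hs
  exact (sq_nonneg _).not_gt hs

lemma mem_of_mem_roots (hp : IsMonicOrthogonal L n p) (hL : IsPositiveOn L S)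
    (hS : IsPreconnected S) (ha : a ∈ p.roots) : a ∈ S := by
  obtain ⟨s, hs, hs0⟩ := hp.exists_root_of_dvd hL hS (g := X - C a)
    (dvd_iff_isRoot.2 (isRoot_of_mem_roots ha)) (by simp)
  rw [eval_sub, eval_X, eval_C, sub_eq_zero] at hs0
  rwa [← hs0]

lemma exists_strictMono_nodes (hp : IsMonicOrthogonal L n p) (hL : IsPositiveOn L (Ioo a b)) :
    ∃ t : Fin (n + 1) → ℝ, StrictMono t ∧ t (Fin.last n) = b ∧
      ∀ i, (p * (X - C b)).eval (t i) = 0 := by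
  have hlt : ∀ c ∈ p.roots.toFinset, c < b := fun c hc =>
    (hp.mem_of_mem_roots hL isPreconnected_Ioo (Multiset.mem_toFinset.1 hc)).2
  have hcard : (insert b p.roots.toFinset).card = n + 1 := by
    rw [Finset.card_insert_of_notMem fun h => (hlt b h).false,
      Multiset.toFinset_card_of_nodup (hp.nodup_roots hL),
      ← (hp.splits hL isPreconnected_Ioo).natDegree_eq_card_roots, hp.natDegree_eq]
  have hmem := Finset.orderEmbOfFin_mem _ hcard
  refine ⟨_, (Finset.orderEmbOfFin _ hcard).strictMono, le_antisymm ?_ ?_, fun i => ?_⟩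
  · rcases Finset.mem_insert.1 (hmem (Fin.last n)) with h | h
    exacts [h.le, (hlt _ h).le]
  · obtain ⟨j, hj⟩ : b ∈ range (Finset.orderEmbOfFin _ hcard) := by
      rw [Finset.range_orderEmbOfFin]
      exact Finset.mem_insert_self b _
    exact hj.ge.trans ((Finset.orderEmbOfFin _ hcard).monotone (Fin.le_last j))
  · rw [eval_mul, eval_sub, eval_X, eval_C]
    rcases Finset.mem_insert.1 (hmem i) with h | h
    · rw [h, sub_self, mul_zero]
    · rw [(isRoot_of_mem_roots (Multiset.mem_toFinset.1 h)).eq_zero, zero_mul]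

end IsMonicOrthogonal

lemma map_eq_sum_lagrange (L : ℝ[X] →ₗ[ℝ] ℝ) {m : ℕ} {t : Fin m → ℝ} (ht : t.Injective)
    (hp : p.degree < m) :
    L p = ∑ i, L (Lagrange.basis Finset.univ t i) * p.eval (t i) := by
  conv_lhs => rw [Lagrange.eq_interpolate (s := Finset.univ) ht.injOn (f := p)
    (by simpa using hp),
    Lagrange.interpolate_apply, map_sum]
  exact Finset.sum_congr rfl fun i _ => by
    rw [← smul_eq_C_mul, map_smul, smul_eq_mul, mul_comm]

/-- Jacobi's theorem: interpolatory quadrature at the zeros of `N` gains as many degrees of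
exactness as `N` is orthogonal to. -/
lemma map_eq_sum_lagrange_of_orthogonal {m k : ℕ} {t : Fin m → ℝ} (ht : t.Injective) {N : ℝ[X]}
    (hN : N.Monic) (hNm : N.natDegree = m) (hNt : ∀ i, N.eval (t i) = 0)
    (horth : ∀ d : ℝ[X], d.degree < k → L (N * d) = 0) (hp : p.natDegree < m + k) :
    L p = ∑ i, L (Lagrange.basis Finset.univ t i) * p.eval (t i) := by
  have hdiv : p %ₘ N + N * (p /ₘ N) = p := modByMonic_add_div p N
  have hrem : (p %ₘ N).degree < m := by
    rw [← hNm, ← degree_eq_natDegree hN.ne_zero]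
    exact degree_modByMonic_lt p hN
  have hquot : (p /ₘ N).degree < k := by
    by_cases h0 : p /ₘ N = 0
    · rw [h0, degree_zero]; exact WithBot.bot_lt_coe _
    · have hle : m ≤ p.natDegree := by
        by_contra! h
        exact h0 ((divByMonic_eq_zero_iff hN).2 (degree_lt_degree (hNm ▸ h)))
      rw [degree_eq_natDegree h0, natDegree_divByMonic p hN, hNm]
      exact_mod_cast (by omega : p.natDegree - m < k)
  have heval : ∀ i, p.eval (t i) = (p %ₘ N).eval (t i) := fun i => by
    conv_lhs => rw [← hdiv, eval_add, eval_mul, hNt, zero_mul, add_zero]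
  conv_lhs => rw [← hdiv, map_add, horth _ hquot, add_zero, map_eq_sum_lagrange L ht hrem]
  simp only [heval]

theorem IsPositiveOn.exists_isGaussRadau (hL : IsPositiveOn L (Ioo a b)) {m : ℕ} (hm : 1 ≤ m) :
    ∃ t w : Fin m → ℝ, IsGaussRadau L b t w := by
  obtain ⟨n, rfl⟩ := Nat.exists_eq_add_of_le' hm
  have hb : (C b - X : ℝ[X]) ≠ 0 := sub_ne_zero.2 (X_ne_C b).symm
  have hL' : IsPositiveOn (L ∘ₗ LinearMap.mulLeft ℝ (C b - X)) (Ioo a b) :=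
    hL.comp_mulLeft hb fun s hs => by simpa using hs.2.le
  obtain ⟨p, hp⟩ := hL'.exists_isMonicOrthogonal n
  obtain ⟨t, ht, htb, hzero⟩ := hp.exists_strictMono_nodes hL'
  have horth : ∀ d : ℝ[X], d.degree < n → L (p * (X - C b) * d) = 0 := fun d hd => by
    have h : L ((C b - X) * (p * d)) = 0 := hp.orthogonal d hd
    rw [show p * (X - C b) * d = -((C b - X) * (p * d)) by ring, map_neg, h, neg_zero]
  refine ⟨t, fun i => L (Lagrange.basis Finset.univ t i), ht, fun i hi => ?_, fun q hq => ?_⟩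
  · rwa [show i = Fin.last n from Fin.ext (by simpa using hi)]
  · refine map_eq_sum_lagrange_of_orthogonal ht.injective (hp.monic.mul (monic_X_sub_C b)) ?_
      hzero horth (by omega)
    rw [hp.monic.natDegree_mul (monic_X_sub_C b), hp.natDegree_eq, natDegree_X_sub_C]

lemma natDegree_prod_X_sub_C_sq {ι : Type*} (s : Finset ι) (t : ι → ℝ) :
    (∏ j ∈ s, (X - C (t j)) ^ 2).natDegree = 2 * s.card := by
  rw [natDegree_prod_of_monic _ _ fun j _ => (monic_X_sub_C _).pow 2]
  simp only [natDegree_pow, natDegree_X_sub_C, Finset.sum_const, smul_eq_mul]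
  ring

lemma eval_prod_X_sub_C_sq_nonneg {ι : Type*} (s : Finset ι) (t : ι → ℝ) (r : ℝ) :
    0 ≤ (∏ j ∈ s, (X - C (t j)) ^ 2).eval r := by
  rw [eval_prod]
  exact Finset.prod_nonneg fun j _ => by rw [eval_pow]; exact sq_nonneg _

lemma eval_prod_X_sub_C_sq_eq_zero {ι : Type*} {s : Finset ι} {j : ι} (t : ι → ℝ) (hj : j ∈ s) :
    (∏ j ∈ s, (X - C (t j)) ^ 2).eval (t j) = 0 := by
  rw [eval_prod]
  exact Finset.prod_eq_zero hj (by simp)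

lemma monic_prod_X_sub_C_sq {ι : Type*} (s : Finset ι) (t : ι → ℝ) :
    (∏ j ∈ s, (X - C (t j)) ^ 2).Monic :=
  monic_prod_of_monic _ _ fun _ _ => (monic_X_sub_C _).pow 2

namespace IsGaussRadau

variable {m : ℕ} {t w : Fin m → ℝ}

lemma le_last (h : IsGaussRadau L b t w) (i : Fin m) : t i ≤ b := by
  have hi := i.2
  rw [← h.last_eq ⟨m - 1, by omega⟩ (by simp; omega)]
  exact h.strictMono.monotone (Fin.le_def.2 (by simp; omega))

lemma weight_pos (h : IsGaussRadau L b t w) (hL : IsPositiveOn L S) (i : Fin m) : 0 < w i := by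
  have hi := i.2
  let p : ℝ[X] := ∏ j ∈ Finset.univ.erase i, (X - C (t j)) ^ 2
  have hdeg : p.natDegree + 2 ≤ 2 * m := by
    rw [natDegree_prod_X_sub_C_sq, Finset.card_erase_of_mem (Finset.mem_univ i), Finset.card_univ,
      Fintype.card_fin]
    omega
  have hpos : 0 < L p := hL p (monic_prod_X_sub_C_sq _ _).ne_zero fun s _ =>
    eval_prod_X_sub_C_sq_nonneg _ _ s
  rw [h.exact_on p hdeg, Finset.sum_eq_single_of_mem i (Finset.mem_univ i) fun j hj hji => by
    rw [eval_prod_X_sub_C_sq_eq_zero t (Finset.mem_erase.2 ⟨hji, hj⟩), mul_zero]] at hpos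
  exact pos_of_mul_pos_left hpos (eval_prod_X_sub_C_sq_nonneg _ _ _)

/-- If some node `t i` were outside, then `(b - X) (X - t i) ∏ (X - t j) ^ 2`, the product over
the remaining nodes, would be positive on the interval and vanish at every node. -/
lemma lt_node (h : IsGaussRadau L b t w) (hL : IsPositiveOn L (Ioo a b)) (hab : a < b)
    (i : Fin m) : a < t i := by
  by_contra! hia
  have hi := i.2
  let l : Fin m := ⟨m - 1, by omega⟩
  have hl : t l = b := h.last_eq l (by simp only [l]; omega)
  have hil : l ≠ i := fun hli => by rw [← hli, hl] at hia; linarith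
  let s : Finset (Fin m) := (Finset.univ.erase i).erase l
  have hcard : s.card + 2 = m := by
    rw [Finset.card_erase_of_mem (Finset.mem_erase.2 ⟨hil, Finset.mem_univ l⟩),
      Finset.card_erase_of_mem (Finset.mem_univ i), Finset.card_univ, Fintype.card_fin]
    have := Fin.val_ne_of_ne hil
    omega
  let q : ℝ[X] := (C b - X) * (X - C (t i))
  let p : ℝ[X] := q * ∏ j ∈ s, (X - C (t j)) ^ 2
  have hp0 : p ≠ 0 := mul_ne_zero (mul_ne_zero (sub_ne_zero.2 (X_ne_C b).symm)
    (X_sub_C_ne_zero _)) (monic_prod_X_sub_C_sq _ _).ne_zero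
  have hdeg : p.natDegree + 2 ≤ 2 * m := by
    have hq : q.natDegree ≤ 2 := by simp only [q]; compute_degree
    have := natDegree_mul_le (p := q) (q := ∏ j ∈ s, (X - C (t j)) ^ 2)
    rw [natDegree_prod_X_sub_C_sq] at this
    change (q * _).natDegree + 2 ≤ 2 * m
    omega
  have hpos : 0 < L p := hL p hp0 fun r hr => by
    rw [eval_mul, eval_mul, eval_sub, eval_sub, eval_X, eval_C, eval_C]
    exact mul_nonneg (mul_nonneg (sub_nonneg.2 hr.2.le) (sub_nonneg.2 (hia.trans hr.1.le)))
      (eval_prod_X_sub_C_sq_nonneg _ _ r)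
  have hzero : ∀ j, p.eval (t j) = 0 := by
    intro j
    by_cases hj : j ∈ s
    · rw [eval_mul, eval_prod_X_sub_C_sq_eq_zero t hj, mul_zero]
    · obtain rfl | rfl : j = l ∨ j = i := by simpa [s, or_iff_not_imp_left] using hj
      all_goals simp [p, q, hl]
  rw [h.exact_on p hdeg, Finset.sum_eq_zero fun j _ => by rw [hzero, mul_zero]] at hpos
  exact hpos.false

end IsGaussRadau

end GaussRadau

section GaussRadauJacobi

open Polynomial MeasureTheory Set

/-- The weight function of the Gauss-Radau-Jacobi quadrature. -/
noncomputable def jacobiWeight (α s : ℝ) : ℝ := s ^ (α - 1) * (1 - s) ^ (1 - α)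

lemma jacobiWeight_pos {α s : ℝ} (hs : s ∈ Ioo (0 : ℝ) 1) : 0 < jacobiWeight α s :=
  mul_pos (Real.rpow_pos_of_pos hs.1 _) (Real.rpow_pos_of_pos (sub_pos.2 hs.2) _)

variable {α : ℝ}

lemma intervalIntegrable_jacobiWeight (hα : α ∈ Ioo (1 : ℝ) 2) :
    IntervalIntegrable (jacobiWeight α) volume 0 1 := by
  have hleft : IntervalIntegrable (fun s : ℝ => s ^ (1 - α)) volume 0 1 :=
    intervalIntegral.intervalIntegrable_rpow' (by linarith [hα.2])
  have hright : IntervalIntegrable (fun s : ℝ => (1 - s) ^ (1 - α)) volume 0 1 := by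
    simpa using (hleft.comp_sub_left 1).symm
  exact hright.continuousOn_mul
    (ContinuousOn.rpow_const continuousOn_id fun x _ => Or.inr (by linarith [hα.1]))

/-- Integration against a weight function, as a functional on polynomials. -/
noncomputable def weightedIntegral {ω : ℝ → ℝ} {a b : ℝ} (hω : IntervalIntegrable ω volume a b) :
    ℝ[X] →ₗ[ℝ] ℝ where
  toFun p := ∫ s in a..b, p.eval s * ω s
  map_add' p q := by
    simp only [eval_add, add_mul]
    exact intervalIntegral.integral_add (hω.continuousOn_mul p.continuous.continuousOn)
      (hω.continuousOn_mul q.continuous.continuousOn)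
  map_smul' c p := by
    simp only [eval_smul, smul_eq_mul, mul_assoc, RingHom.id_apply]
    exact intervalIntegral.integral_const_mul _ _

lemma isPositiveOn_weightedIntegral {ω : ℝ → ℝ} {a b : ℝ} (hω : IntervalIntegrable ω volume a b)
    (hab : a < b) (hpos : ∀ s ∈ Ioo a b, 0 < ω s) :
    IsPositiveOn (weightedIntegral hω) (Ioo a b) := by
  intro p hp h
  change 0 < ∫ s in a..b, p.eval s * ω s
  have hint := hω.continuousOn_mul p.continuous.continuousOn
  rw [intervalIntegral.integral_pos_iff_support_of_nonneg_ae' _ hint]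
  · have hsub : Ioo a b \ (p.roots.toFinset : Set ℝ) ⊆
        Function.support (fun s => p.eval s * ω s) ∩ Ioc a b := by
      rintro s ⟨hs, hr⟩
      refine ⟨mul_ne_zero ?_ (hpos s hs).ne', Ioo_subset_Ioc_self hs⟩
      simpa [hp] using hr
    refine ⟨hab, lt_of_lt_of_le ?_ (measure_mono hsub)⟩
    rw [measure_sdiff_null (Finset.measure_zero _ _), Real.volume_Ioo]
    exact ENNReal.ofReal_pos.2 (sub_pos.2 hab)
  · rw [uIoc_of_le hab.le, ← restrict_Ioo_eq_restrict_Ioc]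
    exact (ae_restrict_iff' measurableSet_Ioo).2 (Filter.Eventually.of_forall fun s hs =>
      mul_nonneg (h s hs) (hpos s hs).le)

lemma isPositiveOn_jacobi (hα : α ∈ Ioo (1 : ℝ) 2) :
    IsPositiveOn (weightedIntegral (intervalIntegrable_jacobiWeight hα)) (Ioo 0 1) :=
  isPositiveOn_weightedIntegral _ zero_lt_one fun _ => jacobiWeight_pos

lemma isGaussRadauJacobi_iff (hα : α ∈ Ioo (1 : ℝ) 2) {m : ℕ} {t w : Fin m → ℝ} :
    IsGaussRadauJacobi α t w ↔
      IsGaussRadau (weightedIntegral (intervalIntegrable_jacobiWeight hα)) 1 t w :=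
  ⟨fun h => ⟨h.strictMono, h.last_eq_one, h.exact_on⟩,
    fun h => ⟨h.strictMono, h.last_eq, h.exact_on⟩⟩

theorem exists_isGaussRadauJacobi (hα : α ∈ Ioo (1 : ℝ) 2) {m : ℕ} (hm : 1 ≤ m) :
    ∃ t w : Fin m → ℝ, IsGaussRadauJacobi α t w := by
  simpa only [isGaussRadauJacobi_iff hα] using (isPositiveOn_jacobi hα).exists_isGaussRadau hm

namespace IsGaussRadauJacobi

variable {m : ℕ} {t w : Fin m → ℝ}

lemma weight_pos (h : IsGaussRadauJacobi α t w) (hα : α ∈ Ioo (1 : ℝ) 2) (i : Fin m) :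
    0 < w i :=
  ((isGaussRadauJacobi_iff hα).1 h).weight_pos (isPositiveOn_jacobi hα) i

lemma node_mem_Ioc (h : IsGaussRadauJacobi α t w) (hα : α ∈ Ioo (1 : ℝ) 2) (i : Fin m) :
    t i ∈ Ioc (0 : ℝ) 1 :=
  ⟨((isGaussRadauJacobi_iff hα).1 h).lt_node (isPositiveOn_jacobi hα) zero_lt_one i,
    ((isGaussRadauJacobi_iff hα).1 h).le_last i⟩

end IsGaussRadauJacobi

end GaussRadauJacobi

/-! ### The quadrature bound for powers -/

section RadauError

open Polynomial MeasureTheory Set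

lemma exists_eval_eq_inv_sub_mul (N : ℝ[X]) {c : ℝ} (hc : N.eval c ≠ 0) :
    ∃ p : ℝ[X], p.natDegree ≤ N.natDegree - 1 ∧
      ∀ s, s ≠ c → p.eval s = (s - c)⁻¹ * (1 - (N.eval c)⁻¹ * N.eval s) := by
  let q : ℝ[X] := 1 - C (N.eval c)⁻¹ * N
  have hroot : q.IsRoot c := by simp [q, IsRoot.def, hc]
  refine ⟨q /ₘ (X - C c), ?_, fun s hs => ?_⟩
  · rw [natDegree_divByMonic _ (monic_X_sub_C c), natDegree_X_sub_C]
    refine Nat.sub_le_sub_right ((natDegree_sub_le _ _).trans ?_) 1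
    exact max_le (by simp) (natDegree_C_mul_le _ _)
  · have h := congrArg (eval s) (mul_divByMonic_eq_iff_isRoot.2 hroot)
    rw [eval_mul, eval_sub, eval_X, eval_C] at h
    rw [eq_inv_mul_iff_mul_eq₀ (sub_ne_zero.2 hs), h]
    simp [q]

/-- The nodal polynomial of a Radau rule: a simple zero at the prescribed node `t l` and double
zeros at the others, so that it keeps its sign on each side of `t l`. -/
noncomputable def radauNodal {ι : Type*} [Fintype ι] [DecidableEq ι] (t : ι → ℝ) (l : ι) : ℝ[X] :=
  (X - C (t l)) * ∏ j ∈ Finset.univ.erase l, (X - C (t j)) ^ 2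

section RadauNodal

variable {ι : Type*} [Fintype ι] [DecidableEq ι] (t : ι → ℝ) (l : ι)

lemma natDegree_radauNodal : (radauNodal t l).natDegree + 1 = 2 * Fintype.card ι := by
  have hcard : 0 < Fintype.card ι := Fintype.card_pos_iff.2 ⟨l⟩
  rw [radauNodal, (monic_X_sub_C _).natDegree_mul (monic_prod_X_sub_C_sq _ _), natDegree_X_sub_C,
    natDegree_prod_X_sub_C_sq, Finset.card_erase_of_mem (Finset.mem_univ l), Finset.card_univ]
  omega

lemma eval_radauNodal_node (i : ι) : (radauNodal t l).eval (t i) = 0 := by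
  rw [radauNodal, eval_mul]
  rcases eq_or_ne i l with rfl | hi
  · simp
  · rw [eval_prod_X_sub_C_sq_eq_zero t (Finset.mem_erase.2 ⟨hi, Finset.mem_univ i⟩), mul_zero]

variable {t l}

lemma eval_radauNodal_ne_zero {c : ℝ} (hc : ∀ j, c ≠ t j) : (radauNodal t l).eval c ≠ 0 := by
  simp only [radauNodal, eval_mul, eval_prod, eval_pow, eval_sub, eval_X, eval_C]
  exact mul_ne_zero (sub_ne_zero.2 (hc l))
    (Finset.prod_ne_zero_iff.2 fun j _ => pow_ne_zero 2 (sub_ne_zero.2 (hc j)))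

lemma inv_sub_mul_radauNodal_nonneg {a c s : ℝ} (hc : c ∉ Icc a (t l)) (hs : s ∈ Ioo a (t l)) :
    0 ≤ (s - c)⁻¹ * (((radauNodal t l).eval c)⁻¹ * (radauNodal t l).eval s) := by
  have hsign : 0 ≤ (s - c)⁻¹ * (c - t l)⁻¹ * (s - t l) := by
    refine mul_nonneg_of_nonpos_of_nonpos ?_ (sub_nonpos.2 hs.2.le)
    rcases lt_or_ge c a with h | h
    · exact mul_nonpos_of_nonneg_of_nonpos (inv_nonneg.2 (by linarith [hs.1]))
        (inv_nonpos.2 (by linarith [hs.1, hs.2]))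
    · have hlc : t l < c := not_le.1 fun hcl => hc ⟨h, hcl⟩
      exact mul_nonpos_of_nonpos_of_nonneg (inv_nonpos.2 (by linarith [hs.2]))
        (inv_nonneg.2 (by linarith))
  have hsq := mul_nonneg (inv_nonneg.2 (eval_prod_X_sub_C_sq_nonneg (Finset.univ.erase l) t c))
    (eval_prod_X_sub_C_sq_nonneg (Finset.univ.erase l) t s)
  simp only [radauNodal, eval_mul, eval_sub, eval_X, eval_C, mul_inv]
  exact (mul_nonneg hsign hsq).trans_eq (by ring)

end RadauNodal

/-- The rule is exact for `s ↦ (s - c)⁻¹ (1 - N s / N c)` with `N` the nodal polynomial. This agrees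
with `s ↦ (s - c)⁻¹` at the nodes and lies below it on the interval. -/
lemma IsGaussRadau.sum_inv_sub_le {ω : ℝ → ℝ} {a b c : ℝ} {hω : IntervalIntegrable ω volume a b}
    {m : ℕ} {t w : Fin m → ℝ} (h : IsGaussRadau (weightedIntegral hω) b t w) (hm : 1 ≤ m)
    (hab : a < b) (hpos : ∀ s ∈ Ioo a b, 0 < ω s) (hc : c ∉ Icc a b) :
    ∑ i, w i * (t i - c)⁻¹ ≤ ∫ s in a..b, (s - c)⁻¹ * ω s := by
  let last : Fin m := ⟨m - 1, by omega⟩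
  have hlast : t last = b := h.last_eq last (by simp [last]; omega)
  have hnode (i : Fin m) : t i ∈ Icc a b :=
    ⟨(h.lt_node (isPositiveOn_weightedIntegral hω hab hpos) hab i).le, h.le_last i⟩
  have hne {s : ℝ} (hs : s ∈ Icc a b) : s ≠ c := fun hsc => hc (hsc ▸ hs)
  have hdeg : (radauNodal t last).natDegree + 1 = 2 * m := by
    rw [natDegree_radauNodal, Fintype.card_fin]
  obtain ⟨p, hp, hpeval⟩ := exists_eval_eq_inv_sub_mul (radauNodal t last)
    (eval_radauNodal_ne_zero fun j => (hne (hnode j)).symm)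
  have hsum : ∑ i, w i * (t i - c)⁻¹ = ∫ s in a..b, p.eval s * ω s := by
    refine .trans (Finset.sum_congr rfl fun i _ => ?_) (h.exact_on p (by omega)).symm
    rw [hpeval _ (hne (hnode i)), eval_radauNodal_node, mul_zero, sub_zero, mul_one]
  rw [hsum]
  have hcont : ContinuousOn (fun s : ℝ => (s - c)⁻¹) (uIcc a b) :=
    ContinuousOn.inv₀ (by fun_prop) fun s hs =>
      sub_ne_zero.2 (hne (by rwa [uIcc_of_le hab.le] at hs))
  refine intervalIntegral.integral_mono_on_of_le_Ioo hab.le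
    (hω.continuousOn_mul p.continuous.continuousOn) (hω.continuousOn_mul hcont) fun s hs =>
      mul_le_mul_of_nonneg_right ?_ (hpos s hs).le
  rw [hpeval s (hne (Ioo_subset_Icc_self hs)), mul_sub, mul_one]
  rw [← hlast] at hc hs
  exact sub_le_self _ (inv_sub_mul_radauNodal_nonneg hc hs)

end RadauError

section PowerIntegral

open MeasureTheory Set

lemma integral_Ioi_eq_intervalIntegral (g : ℝ → ℝ) :
    ∫ u in Ioi (0 : ℝ), g u = ∫ s in (0 : ℝ)..1, ((1 - s) ^ 2)⁻¹ * g (s / (1 - s)) := by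
  have himage : (fun s : ℝ => s / (1 - s)) '' Ioo 0 1 = Ioi 0 := by
    ext u
    constructor
    · rintro ⟨s, hs, rfl⟩
      exact div_pos hs.1 (sub_pos.2 hs.2)
    · intro (hu : 0 < u)
      refine ⟨u / (1 + u), ⟨by positivity, (div_lt_one (by positivity)).2 (by linarith)⟩, ?_⟩
      field_simp
      ring
  have hderiv (s) (hs : s ∈ Ioo (0 : ℝ) 1) :
      HasDerivWithinAt (fun s : ℝ => s / (1 - s)) ((1 - s) ^ 2)⁻¹ (Ioo 0 1) s := by
    have hs1 : 1 - s ≠ 0 := (sub_pos.2 hs.2).ne'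
    have h := ((hasDerivAt_id s).div ((hasDerivAt_id s).const_sub 1) hs1).hasDerivWithinAt
      (s := Ioo (0 : ℝ) 1)
    convert! h using 1
    simp only [id]
    field_simp
    ring
  have hinj : InjOn (fun s : ℝ => s / (1 - s)) (Ioo 0 1) := fun r hr s hs hrs => by
    have h := (div_eq_div_iff (sub_pos.2 hr.2).ne' (sub_pos.2 hs.2).ne').1 hrs
    linarith
  rw [← himage, integral_image_eq_integral_abs_deriv_smul measurableSet_Ioo hderiv hinj,
    intervalIntegral.integral_of_le zero_le_one, integral_Ioc_eq_integral_Ioo]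
  simp only [abs_inv, abs_sq, smul_eq_mul]

lemma add_one_sub_mul_pos {x s : ℝ} (hx : 0 < x) (hs : s ∈ Icc (0 : ℝ) 1) :
    0 < x + (1 - x) * s := by
  rcases hs.2.eq_or_lt with rfl | hs1
  · linarith
  · nlinarith [hs.1]

variable {p : ℝ}

lemma integral_rpow_mul_one_sub_rpow_neg (hp : p ∈ Ioo (0 : ℝ) 1) :
    ∫ s in (0 : ℝ)..1, s ^ (p - 1) * (1 - s) ^ (-p) = Real.pi / Real.sin (Real.pi * p) := by
  have hbeta : Complex.betaIntegral p (1 - p : ℝ) =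
      ((∫ s in (0 : ℝ)..1, s ^ (p - 1) * (1 - s) ^ (-p) : ℝ) : ℂ) := by
    rw [Complex.betaIntegral, ← intervalIntegral.integral_ofReal]
    refine intervalIntegral.integral_congr fun s hs => ?_
    rw [uIcc_of_le zero_le_one] at hs
    rw [Complex.ofReal_mul, Complex.ofReal_cpow hs.1, Complex.ofReal_cpow (sub_nonneg.2 hs.2)]
    push_cast
    ring_nf
  have h := Complex.Gamma_mul_Gamma_eq_betaIntegral (s := p) (t := (1 - p : ℝ))
    (by simpa using hp.1) (by simpa using hp.2)
  rw [← Complex.ofReal_add, add_sub_cancel, Complex.ofReal_one, Complex.Gamma_one, one_mul,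
    Complex.Gamma_ofReal, Complex.Gamma_ofReal, ← Complex.ofReal_mul,
    Real.Gamma_mul_Gamma_one_sub, hbeta] at h
  exact_mod_cast h.symm

lemma mul_rpowIntegrand₀₁_div_one_sub (hp : p ∈ Ioo (0 : ℝ) 1) {x s : ℝ} (hx : 0 < x)
    (hs : s ∈ Ioo (0 : ℝ) 1) :
    ((1 - s) ^ 2)⁻¹ * Real.rpowIntegrand₀₁ p (s / (1 - s)) x =
      s ^ (p - 1) * (1 - s) ^ (-p) * (x / (x + (1 - x) * s)) := by
  have hs1 : 0 < 1 - s := sub_pos.2 hs.2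
  have hpow : (1 - s) ^ (p - 1) = ((1 - s) ^ (-p))⁻¹ * (1 - s)⁻¹ := by
    rw [← Real.rpow_neg hs1.le, neg_neg, Real.rpow_sub_one hs1.ne', div_eq_mul_inv]
  have hden : s / (1 - s) + x = (x + (1 - x) * s) / (1 - s) := by
    field_simp
    ring
  have hne : (1 - s) ^ (-p) ≠ 0 := (Real.rpow_pos_of_pos hs1 _).ne'
  rw [Real.rpowIntegrand₀₁_eq_pow_div hp (div_nonneg hs.1.le hs1.le) hx.le,
    Real.div_rpow hs.1.le hs1.le, hpow, hden]
  field_simp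

lemma integral_rpowIntegrand₀₁_one (hp : p ∈ Ioo (0 : ℝ) 1) :
    ∫ u in Ioi (0 : ℝ), Real.rpowIntegrand₀₁ p u 1 = Real.pi / Real.sin (Real.pi * p) := by
  rw [integral_Ioi_eq_intervalIntegral, ← integral_rpow_mul_one_sub_rpow_neg hp]
  refine intervalIntegral.integral_congr_Ioo_of_le zero_le_one fun s hs => ?_
  simp [mul_rpowIntegrand₀₁_div_one_sub hp one_pos hs]

lemma integral_rpowIntegrand₀₁_sub (hp : p ∈ Ioo (0 : ℝ) 1) {x : ℝ} (hx : 0 < x) :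
    (∫ u in Ioi (0 : ℝ), Real.rpowIntegrand₀₁ p u x) -
      ∫ u in Ioi (0 : ℝ), Real.rpowIntegrand₀₁ p u 1 =
      - ∫ s in (0 : ℝ)..1, (1 - x) / (x + (1 - x) * s) * (s ^ p * (1 - s) ^ (-p)) := by
  rw [← integral_sub (Real.integrableOn_rpowIntegrand₀₁_Ioi hp hx.le)
    (Real.integrableOn_rpowIntegrand₀₁_Ioi hp zero_le_one), integral_Ioi_eq_intervalIntegral,
    ← intervalIntegral.integral_neg]
  refine intervalIntegral.integral_congr_Ioo_of_le zero_le_one fun s hs => ?_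
  have hs0 := hs.1.ne'
  have hne : x + (1 - x) * s ≠ 0 := (add_one_sub_mul_pos hx (Ioo_subset_Icc_self hs)).ne'
  simp only [mul_sub, mul_rpowIntegrand₀₁_div_one_sub hp hx hs,
    mul_rpowIntegrand₀₁_div_one_sub hp one_pos hs, Real.rpow_sub_one hs.1.ne']
  generalize hd : x + (1 - x) * s = d at hne
  field_simp
  rw [← hd]
  ring

theorem rpow_sub_one_eq_integral {α x : ℝ} (hα : α ∈ Ioo (1 : ℝ) 2) (hx : 0 < x) :
    x ^ (α - 1) = 1 + Real.sin (α * Real.pi) / Real.pi *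
      ∫ s in (0 : ℝ)..1, (1 - x) / (x + (1 - x) * s) * jacobiWeight α s := by
  have hp : α - 1 ∈ Ioo (0 : ℝ) 1 := ⟨by linarith [hα.1], by linarith [hα.2]⟩
  have hsin : Real.sin (Real.pi * (α - 1)) = - Real.sin (α * Real.pi) := by
    rw [mul_comm, sub_mul, one_mul, Real.sin_sub_pi]
  have hne : ∫ u in Ioi (0 : ℝ), Real.rpowIntegrand₀₁ (α - 1) u 1 ≠ 0 :=
    (Real.integral_rpowIntegrand₀₁_one_pos hp).ne'
  rw [Real.rpow_eq_const_mul_integral hp hx.le,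
    sub_eq_iff_eq_add.1 (integral_rpowIntegrand₀₁_sub hp hx), mul_add, inv_mul_cancel₀ hne,
    integral_rpowIntegrand₀₁_one hp, hsin, add_comm, mul_neg, div_neg, inv_neg, neg_mul, neg_neg,
    inv_div, neg_sub]
  rfl

end PowerIntegral

section ScalarBound

open MeasureTheory Set

variable {α : ℝ}

lemma sin_mul_pi_neg (hα : α ∈ Ioo (1 : ℝ) 2) : Real.sin (α * Real.pi) < 0 := by
  have h : 0 < Real.sin ((α - 1) * Real.pi) :=
    Real.sin_pos_of_pos_of_lt_pi (mul_pos (by linarith [hα.1]) Real.pi_pos)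
      (by nlinarith [hα.2, Real.pi_pos])
  rwa [sub_mul, one_mul, Real.sin_sub_pi, Left.neg_pos_iff] at h

namespace IsGaussRadauJacobi

variable {m : ℕ} {t w : Fin m → ℝ}

lemma sum_div_le (h : IsGaussRadauJacobi α t w) (hα : α ∈ Ioo (1 : ℝ) 2) (hm : 1 ≤ m)
    {x : ℝ} (hx : 0 < x) :
    ∑ i, w i * ((1 - x) / (x + (1 - x) * t i)) ≤
      ∫ s in (0 : ℝ)..1, (1 - x) / (x + (1 - x) * s) * jacobiWeight α s := by
  rcases eq_or_ne x 1 with rfl | hx1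
  · simp
  have hx1' : 1 - x ≠ 0 := sub_ne_zero.2 hx1.symm
  have hpole (s : ℝ) : (1 - x) / (x + (1 - x) * s) = (s - -(x / (1 - x)))⁻¹ := by
    rw [sub_neg_eq_add, ← inv_div]
    congr 1
    field_simp
    ring
  have hc : -(x / (1 - x)) ∉ Icc (0 : ℝ) 1 := fun hc => by
    have h0 := add_one_sub_mul_pos hx hc
    rw [mul_neg, mul_div_cancel₀ _ hx1', add_neg_cancel] at h0
    exact h0.false
  simp only [hpole]
  exact ((isGaussRadauJacobi_iff hα).1 h).sum_inv_sub_le hm zero_lt_one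
    (fun _ => jacobiWeight_pos) hc

theorem rpow_mul_rpow_le (h : IsGaussRadauJacobi α t w) (hα : α ∈ Ioo (1 : ℝ) 2) (hm : 1 ≤ m)
    {x y : ℝ} (hx : 0 ≤ x) (hy : 0 < y) :
    x ^ α * y ^ (1 - α) ≤ x + Real.sin (α * Real.pi) / Real.pi *
      ∑ i, w i * (x * (y - x) / (x * (1 - t i) + t i * y)) := by
  rcases hx.eq_or_lt with rfl | hx
  · simp [Real.zero_rpow (by linarith [hα.1] : α ≠ 0)]
  have hratio : x ^ α * y ^ (1 - α) = x * (x / y) ^ (α - 1) := by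
    rw [Real.div_rpow hx.le hy.le, ← neg_sub 1 α, Real.rpow_neg hx.le, Real.rpow_neg hy.le,
      div_inv_eq_mul, ← mul_assoc, ← Real.rpow_neg hx.le, ← Real.rpow_one_add' hx.le] <;>
      ring_nf
    linarith [hα.1]
  have hbound : (x / y) ^ (α - 1) ≤ 1 + Real.sin (α * Real.pi) / Real.pi *
      ∑ i, w i * ((1 - x / y) / (x / y + (1 - x / y) * t i)) := by
    rw [rpow_sub_one_eq_integral hα (div_pos hx hy)]
    exact add_le_add_right (mul_le_mul_of_nonpos_left (h.sum_div_le hα hm (div_pos hx hy))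
      (div_neg_of_neg_of_pos (sin_mul_pi_neg hα) Real.pi_pos).le) 1
  rw [hratio]
  refine (mul_le_mul_of_nonneg_left hbound hx.le).trans_eq ?_
  rw [mul_add, mul_one, mul_left_comm, Finset.mul_sum]
  congr 2
  refine Finset.sum_congr rfl fun i _ => ?_
  have hden : x / y + (1 - x / y) * t i = (x * (1 - t i) + t i * y) / y := by
    field_simp
    ring
  rw [hden]
  generalize x * (1 - t i) + t i * y = d
  field_simp

end IsGaussRadauJacobi

end ScalarBound

/-! ### The variational bound for the Petz trace -/

section PosSemidefTrace

open Matrix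

variable {n : Type*} [Fintype n] {A : Matrix n n ℂ}

open scoped MatrixOrder in
lemma exists_eq_conjTranspose_mul_self (hA : A.PosSemidef) : ∃ B : Matrix n n ℂ, A = Bᴴ * B := by
  classical
  exact CStarAlgebra.nonneg_iff_eq_star_mul_self.mp hA.nonneg

lemma re_trace_mul_nonneg {B : Matrix n n ℂ} (hA : A.PosSemidef) (hB : B.PosSemidef) :
    0 ≤ (A * B).trace.re := by
  obtain ⟨C, rfl⟩ := exists_eq_conjTranspose_mul_self hA
  rw [mul_assoc, trace_mul_comm]
  exact (Complex.le_def.1 (hB.mul_mul_conjTranspose_same C).trace_nonneg).1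

lemma re_trace_mul_conjTranspose (hA : A.IsHermitian) (B : Matrix n n ℂ) :
    (A * Bᴴ).trace.re = (A * B).trace.re := by
  have h : (A * Bᴴ).trace = star (A * B).trace := by
    rw [← trace_conjTranspose, conjTranspose_mul, hA.eq, trace_mul_comm]
  rw [h, Complex.star_def, Complex.conj_re]

end PosSemidefTrace

section SpectralMatrix

open Matrix

variable {n : Type*} [Fintype n]

/-- The operator with matrix elements `z j k * conj ⟨u_j, v_k⟩` from the basis of the columns `u_j`
of `U` to that of the columns `v_k` of `V`. -/
def overlapOperator (U V : Matrix n n ℂ) (z : n → n → ℝ) : Matrix n n ℂ :=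
  V * (of fun k j => (z j k : ℂ) * star ((Uᴴ * V) j k)) * Uᴴ

lemma conjTranspose_overlapOperator (U V : Matrix n n ℂ) (z : n → n → ℝ) :
    (overlapOperator U V z)ᴴ = overlapOperator V U fun k j => z j k := by
  have hentries : (of fun k j => (z j k : ℂ) * star ((Uᴴ * V) j k))ᴴ =
      of fun j k => (z j k : ℂ) * star ((Vᴴ * U) k j) := by
    ext j k
    have hVU : (Vᴴ * U) k j = star ((Uᴴ * V) j k) := by
      rw [← conjTranspose_apply, conjTranspose_mul, conjTranspose_conjTranspose]
    simp [hVU]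
  rw [overlapOperator, conjTranspose_mul, conjTranspose_mul, conjTranspose_conjTranspose,
    hentries, ← mul_assoc, overlapOperator]

variable [DecidableEq n]

/-- The matrix `U diag(a) U†`: when `U` is unitary, the Hermitian matrix with eigenvalues `a` whose
eigenvectors are the columns of `U`. -/
def spectralMatrix (U : Matrix n n ℂ) (a : n → ℝ) : Matrix n n ℂ :=
  U * diagonal (fun i => (a i : ℂ)) * Uᴴ

lemma exists_spectralMatrix {ρ : Matrix n n ℂ} (hρ : ρ.PosSemidef) :
    ∃ (U : Matrix n n ℂ) (l : n → ℝ), Uᴴ * U = 1 ∧ (∀ j, 0 ≤ l j) ∧ ρ = spectralMatrix U l ∧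
      ∀ s, matPow ρ s = spectralMatrix U fun j => l j ^ s := by
  refine ⟨hρ.1.eigenvectorUnitary, hρ.1.eigenvalues,
    Unitary.coe_star_mul_self hρ.1.eigenvectorUnitary, hρ.eigenvalues_nonneg, ?_, fun s => ?_⟩
  · have hspec := hρ.1.spectral_theorem
    rwa [Unitary.conjStarAlgAut_apply] at hspec
  · rw [matPow, hρ.1.cfc_eq, IsHermitian.cfc, Unitary.conjStarAlgAut_apply]
    rfl

variable {U V : Matrix n n ℂ}

lemma re_trace_spectralMatrix_mul (U : Matrix n n ℂ) (a : n → ℝ) (A : Matrix n n ℂ) :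
    (spectralMatrix U a * A).trace.re = ∑ j, a j * ((Uᴴ * A * U) j j).re := by
  have hcycle : (spectralMatrix U a * A).trace =
      (diagonal (fun i => (a i : ℂ)) * (Uᴴ * A * U)).trace := by
    rw [spectralMatrix, mul_assoc, mul_assoc, trace_mul_comm U]
    simp only [mul_assoc]
  rw [hcycle, Matrix.trace, Complex.re_sum]
  simp only [diag_apply, diagonal_mul, Complex.re_ofReal_mul]

lemma re_trace_spectralMatrix (hU : Uᴴ * U = 1) (a : n → ℝ) :
    (spectralMatrix U a).trace.re = ∑ j, a j := by
  simpa [hU] using re_trace_spectralMatrix_mul U a 1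

lemma re_trace_spectralMatrix_mul_spectralMatrix (U V : Matrix n n ℂ) (a b : n → ℝ) :
    (spectralMatrix U a * spectralMatrix V b).trace.re =
      ∑ j, ∑ k, a j * b k * Complex.normSq ((Uᴴ * V) j k) := by
  have hconj : Uᴴ * spectralMatrix V b * U =
      (Uᴴ * V) * diagonal (fun i => (b i : ℂ)) * (Uᴴ * V)ᴴ := by
    simp only [spectralMatrix, conjTranspose_mul, conjTranspose_conjTranspose, mul_assoc]
  rw [re_trace_spectralMatrix_mul, hconj]
  refine Finset.sum_congr rfl fun j _ => ?_
  rw [Matrix.mul_apply, Complex.re_sum, Finset.mul_sum]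
  refine Finset.sum_congr rfl fun k _ => ?_
  rw [mul_diagonal, conjTranspose_apply, mul_right_comm, Complex.star_def, Complex.mul_conj,
    ← Complex.ofReal_mul, Complex.ofReal_re]
  ring

lemma sum_normSq_conjTranspose_mul (hU : Uᴴ * U = 1) (hV : Vᴴ * V = 1) (j : n) :
    ∑ k, Complex.normSq ((Uᴴ * V) j k) = 1 := by
  have hunit : (Uᴴ * V) * (Uᴴ * V)ᴴ = 1 := by
    rw [conjTranspose_mul, conjTranspose_conjTranspose, mul_assoc, ← mul_assoc V,
      mul_eq_one_comm.1 hV, one_mul, hU]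
  have hjj := congrArg Complex.re (congrFun (congrFun hunit j) j)
  rw [Matrix.mul_apply, Complex.re_sum, one_apply_eq, Complex.one_re] at hjj
  rw [← hjj]
  refine Finset.sum_congr rfl fun k _ => ?_
  rw [conjTranspose_apply, Complex.star_def, Complex.mul_conj, Complex.ofReal_re]

lemma mul_normSq_eq_zero_of_ker_le {l μ : n → ℝ} (hU : Uᴴ * U = 1) (hV : Vᴴ * V = 1)
    (hker : ∀ v, spectralMatrix V μ *ᵥ v = 0 → spectralMatrix U l *ᵥ v = 0) {j k : n}
    (hk : μ k = 0) : l j * Complex.normSq ((Uᴴ * V) j k) = 0 := by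
  have hVk : spectralMatrix V μ *ᵥ (V *ᵥ Pi.single k 1) = 0 := by
    rw [spectralMatrix, mulVec_mulVec, mul_assoc, hV, mul_one, ← mulVec_mulVec,
      diagonal_mulVec_single, hk, Complex.ofReal_zero, zero_mul, Pi.single_zero, mulVec_zero]
  have hUk : Uᴴ *ᵥ (spectralMatrix U l *ᵥ (V *ᵥ Pi.single k 1)) = 0 := by
    rw [hker _ hVk, mulVec_zero]
  rw [spectralMatrix, mulVec_mulVec, mulVec_mulVec, ← mul_assoc, ← mul_assoc, hU, one_mul,
    mul_assoc] at hUk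
  have hjk := congrFun hUk j
  rw [mulVec_single_one, col_apply, diagonal_mul, Pi.zero_apply] at hjk
  rcases mul_eq_zero.1 hjk with h | h
  · rw [Complex.ofReal_eq_zero.1 h, zero_mul]
  · rw [h, map_zero, mul_zero]

lemma re_trace_matPow_mul_matPow_pos {ρ σ : Matrix n n ℂ} (hρ : ρ.PosSemidef)
    (hσ : σ.PosSemidef) (hker : ∀ v, σ *ᵥ v = 0 → ρ *ᵥ v = 0) (htr : 0 < ρ.trace.re) (α β : ℝ) :
    0 < (matPow ρ α * matPow σ β).trace.re := by
  obtain ⟨U, l, hU, hl, rfl, hUpow⟩ := exists_spectralMatrix hρ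
  obtain ⟨V, μ, hV, hμ, rfl, hVpow⟩ := exists_spectralMatrix hσ
  rw [hUpow, hVpow, re_trace_spectralMatrix_mul_spectralMatrix]
  have hterm : ∀ j k, 0 ≤ l j ^ α * μ k ^ β * Complex.normSq ((Uᴴ * V) j k) := fun j k =>
    mul_nonneg (mul_nonneg (Real.rpow_nonneg (hl j) _) (Real.rpow_nonneg (hμ k) _))
      (Complex.normSq_nonneg _)
  rw [re_trace_spectralMatrix hU] at htr
  obtain ⟨j, -, hj⟩ := Finset.exists_lt_of_sum_lt (f := fun _ : n => (0 : ℝ)) (by simpa using htr)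
  have hrow : ∑ _k : n, (0 : ℝ) < ∑ k, Complex.normSq ((Uᴴ * V) j k) := by
    rw [sum_normSq_conjTranspose_mul hU hV, Finset.sum_const_zero]
    exact one_pos
  obtain ⟨k, -, hk⟩ := Finset.exists_lt_of_sum_lt hrow
  have hμk : 0 < μ k := (hμ k).lt_of_ne fun h =>
    (mul_pos hj hk).ne' (mul_normSq_eq_zero_of_ker_le hU hV hker h.symm)
  refine Finset.sum_pos' (fun j _ => Finset.sum_nonneg fun k _ => hterm j k)
    ⟨j, Finset.mem_univ j, Finset.sum_pos' (fun k _ => hterm j k) ⟨k, Finset.mem_univ k, ?_⟩⟩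
  exact mul_pos (mul_pos (Real.rpow_pos_of_pos hj _) (Real.rpow_pos_of_pos hμk _)) hk

lemma re_trace_spectralMatrix_mul_overlapOperator (hU : Uᴴ * U = 1) (V : Matrix n n ℂ)
    (a : n → ℝ) (z : n → n → ℝ) :
    (spectralMatrix U a * overlapOperator U V z).trace.re =
      ∑ j, ∑ k, a j * z j k * Complex.normSq ((Uᴴ * V) j k) := by
  rw [re_trace_spectralMatrix_mul, overlapOperator, mul_assoc, mul_assoc, hU, mul_one, ← mul_assoc]
  refine Finset.sum_congr rfl fun j _ => ?_
  rw [Matrix.mul_apply, Complex.re_sum, Finset.mul_sum]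
  refine Finset.sum_congr rfl fun k _ => ?_
  rw [of_apply, mul_left_comm, Complex.star_def, Complex.mul_conj, ← Complex.ofReal_mul,
    Complex.ofReal_re]
  ring

lemma re_trace_spectralMatrix_mul_conjTranspose_overlapOperator_mul_self (hU : Uᴴ * U = 1)
    (hV : Vᴴ * V = 1) (a : n → ℝ) (z : n → n → ℝ) :
    (spectralMatrix U a * ((overlapOperator U V z)ᴴ * overlapOperator U V z)).trace.re =
      ∑ j, ∑ k, a j * z j k ^ 2 * Complex.normSq ((Uᴴ * V) j k) := by
  set K : Matrix n n ℂ := of fun k j => (z j k : ℂ) * star ((Uᴴ * V) j k) with hK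
  have hconj : Uᴴ * ((V * K * Uᴴ)ᴴ * (V * K * Uᴴ)) * U = Kᴴ * K := by
    calc Uᴴ * ((V * K * Uᴴ)ᴴ * (V * K * Uᴴ)) * U = (Uᴴ * U) * Kᴴ * (Vᴴ * V) * K * (Uᴴ * U) := by
          simp only [conjTranspose_mul, conjTranspose_conjTranspose, mul_assoc]
      _ = Kᴴ * K := by rw [hU, hV, one_mul, mul_one, mul_one]
  rw [re_trace_spectralMatrix_mul, overlapOperator, ← hK, hconj]
  refine Finset.sum_congr rfl fun j _ => ?_
  rw [Matrix.mul_apply, Complex.re_sum, Finset.mul_sum]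
  refine Finset.sum_congr rfl fun k _ => ?_
  rw [conjTranspose_apply, Complex.star_def, mul_comm (starRingEnd ℂ _), Complex.mul_conj,
    Complex.ofReal_re, hK, of_apply, map_mul, Complex.star_def, Complex.normSq_conj,
    Complex.normSq_ofReal]
  ring

lemma re_trace_spectralMatrix_mul_overlapOperator_mul_conjTranspose (hU : Uᴴ * U = 1)
    (hV : Vᴴ * V = 1) (b : n → ℝ) (z : n → n → ℝ) :
    (spectralMatrix V b * (overlapOperator U V z * (overlapOperator U V z)ᴴ)).trace.re =
      ∑ j, ∑ k, b k * z j k ^ 2 * Complex.normSq ((Uᴴ * V) j k) := by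
  have hadj : overlapOperator U V z = (overlapOperator V U fun k j => z j k)ᴴ := by
    rw [conjTranspose_overlapOperator]
  have hnorm : ∀ j k, Complex.normSq ((Vᴴ * U) k j) = Complex.normSq ((Uᴴ * V) j k) := fun j k => by
    rw [← Complex.normSq_conj, ← Complex.star_def, ← conjTranspose_apply, conjTranspose_mul,
      conjTranspose_conjTranspose]
  rw [hadj, conjTranspose_conjTranspose,
    re_trace_spectralMatrix_mul_conjTranspose_overlapOperator_mul_self hV hU, Finset.sum_comm]
  simp only [hnorm]

end SpectralMatrix

section QuadratureTrace

open Matrix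

variable {n : Type*} [Fintype n] {α : ℝ} {m : ℕ} {t w : Fin m → ℝ}

/-- The operator `Q(Z_1, …, Z_m)` that the quadrature pairs with the second argument of the trace
`Tr[ρ^α σ^(1-α)]`. -/
noncomputable def quadratureQ (α : ℝ) (w : Fin m → ℝ) (Z : Fin m → Matrix n n ℂ) :
    Matrix n n ℂ :=
  (Real.sin (α * Real.pi) / Real.pi) • ∑ i, w i • (Z i * (Z i)ᴴ)

variable [DecidableEq n]

/-- The operator `P(Z_1, …, Z_m)` that the quadrature pairs with the first argument of the trace
`Tr[ρ^α σ^(1-α)]`. -/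
noncomputable def quadratureP (α : ℝ) (t w : Fin m → ℝ) (Z : Fin m → Matrix n n ℂ) :
    Matrix n n ℂ :=
  1 + (Real.sin (α * Real.pi) / Real.pi) • ∑ i, (w i / t i) •
    (1 + Z i + (Z i)ᴴ + (1 - t i) • ((Z i)ᴴ * Z i))

/-- The trace form `Tr[ρ P(Z)] + Tr[σ Q(Z)]`, whose minimum over `Z` bounds `Tr[ρ^α σ^(1-α)]` from
above. -/
noncomputable def quadratureTrace (α : ℝ) (t w : Fin m → ℝ) (ρ σ : Matrix n n ℂ)
    (Z : Fin m → Matrix n n ℂ) : ℝ :=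
  (ρ * quadratureP α t w Z).trace.re + (σ * quadratureQ α w Z).trace.re

lemma quadratureTrace_eq (α : ℝ) (t w : Fin m → ℝ) (ρ σ : Matrix n n ℂ)
    (Z : Fin m → Matrix n n ℂ) :
    quadratureTrace α t w ρ σ Z =
      ρ.trace.re + Real.sin (α * Real.pi) / Real.pi * ∑ i,
        (w i / t i * (ρ.trace.re + (ρ * Z i).trace.re + (ρ * (Z i)ᴴ).trace.re +
            (1 - t i) * (ρ * ((Z i)ᴴ * Z i)).trace.re) +
          w i * (σ * (Z i * (Z i)ᴴ)).trace.re) := by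
  simp only [quadratureTrace, quadratureP, quadratureQ, mul_add, mul_one, mul_smul_comm,
    Finset.mul_sum, trace_add, trace_smul, trace_sum, Complex.add_re, Complex.smul_re,
    Complex.re_sum, smul_eq_mul, Finset.sum_add_distrib]
  ring

lemma quadratureTrace_spectralMatrix_overlapOperator {U V : Matrix n n ℂ} (hU : Uᴴ * U = 1)
    (hV : Vᴴ * V = 1) (α : ℝ) (t w : Fin m → ℝ) (l μ : n → ℝ) (z : Fin m → n → n → ℝ) :
    quadratureTrace α t w (spectralMatrix U l) (spectralMatrix V μ)
        (fun i => overlapOperator U V (z i)) =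
      ∑ j, ∑ k, (l j + Real.sin (α * Real.pi) / Real.pi * ∑ i,
        (w i / t i * (l j + l j * z i j k + l j * z i j k + (1 - t i) * (l j * z i j k ^ 2)) +
          w i * (μ k * z i j k ^ 2))) * Complex.normSq ((Uᴴ * V) j k) := by
  have hherm : (spectralMatrix U l).IsHermitian :=
    isHermitian_mul_mul_conjTranspose U (isHermitian_diagonal_of_self_adjoint _
      (funext fun i => Complex.conj_ofReal (l i)))
  have htr : (spectralMatrix U l).trace.re = ∑ j, ∑ k, l j * Complex.normSq ((Uᴴ * V) j k) := by
    simp only [re_trace_spectralMatrix hU, ← Finset.mul_sum, sum_normSq_conjTranspose_mul hU hV,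
      mul_one]
  simp only [quadratureTrace_eq, htr, re_trace_mul_conjTranspose hherm,
    re_trace_spectralMatrix_mul_overlapOperator hU,
    re_trace_spectralMatrix_mul_conjTranspose_overlapOperator_mul_self hU hV,
    re_trace_spectralMatrix_mul_overlapOperator_mul_conjTranspose hU hV]
  simp only [add_mul, Finset.sum_add_distrib, Finset.mul_sum, Finset.sum_mul, mul_add]
  congr 1
  simp only [← Finset.sum_add_distrib]
  rw [Finset.sum_comm]
  refine Finset.sum_congr rfl fun j _ => ?_
  rw [Finset.sum_comm]
  refine Finset.sum_congr rfl fun k _ => Finset.sum_congr rfl fun i _ => ?_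
  ring

lemma quadrature_term_at_minimizer {l μ t d : ℝ} (w : ℝ) (ht : t ≠ 0) (hd : d ≠ 0)
    (hdef : l * (1 - t) + t * μ = d) :
    w / t * (l + l * -(l / d) + l * -(l / d) + (1 - t) * (l * (-(l / d)) ^ 2)) +
      w * (μ * (-(l / d)) ^ 2) = w * (l * (μ - l) / d) := by
  have hμ : μ = (d - l * (1 - t)) / t := by rw [← hdef]; field_simp; ring
  rw [hμ]
  field_simp
  ring

theorem IsGaussRadauJacobi.exists_trace_le (hα : α ∈ Set.Ioo (1 : ℝ) 2)
    (h : IsGaussRadauJacobi α t w) (hm : 1 ≤ m) {ρ σ : Matrix n n ℂ} (hρ : ρ.PosSemidef)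
    (hσ : σ.PosSemidef) (hker : ∀ v, σ *ᵥ v = 0 → ρ *ᵥ v = 0) :
    ∃ Z : Fin m → Matrix n n ℂ,
      (matPow ρ α * matPow σ (1 - α)).trace.re ≤ quadratureTrace α t w ρ σ Z := by
  obtain ⟨U, l, hU, hl, rfl, hUpow⟩ := exists_spectralMatrix hρ
  obtain ⟨V, μ, hV, hμ, rfl, hVpow⟩ := exists_spectralMatrix hσ
  refine ⟨fun i => overlapOperator U V fun j k => -(l j / (l j * (1 - t i) + t i * μ k)), ?_⟩
  rw [hUpow, hVpow, re_trace_spectralMatrix_mul_spectralMatrix,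
    quadratureTrace_spectralMatrix_overlapOperator hU hV]
  refine Finset.sum_le_sum fun j _ => Finset.sum_le_sum fun k _ => ?_
  rcases (hμ k).eq_or_lt with hk | hk
  · rcases mul_eq_zero.1 (mul_normSq_eq_zero_of_ker_le hU hV hker (j := j) hk.symm) with h0 | h0
    · simp [h0, Real.zero_rpow (one_pos.trans hα.1).ne']
    · simp [h0]
  · refine mul_le_mul_of_nonneg_right ?_ (Complex.normSq_nonneg _)
    refine (h.rpow_mul_rpow_le hα hm (hl j) hk).trans_eq ?_
    congr 2
    refine Finset.sum_congr rfl fun i _ => ?_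
    have ht := h.node_mem_Ioc hα i
    have hd : 0 < l j * (1 - t i) + t i * μ k :=
      add_pos_of_nonneg_of_pos (mul_nonneg (hl j) (sub_nonneg.2 ht.2)) (mul_pos ht.1 hk)
    exact (quadrature_term_at_minimizer (w i) ht.1.ne' hd.ne' rfl).symm

end QuadratureTrace

section Compression

open Matrix

variable {n k : Type*} [Fintype n] [Fintype k] {α : ℝ} {m : ℕ} {t w : Fin m → ℝ}

lemma posSemidef_submatrix_sub (K : Matrix n n ℂ) {f : k → n} (hf : Function.Injective f) :
    ((Kᴴ * K).submatrix f f - (K.submatrix f f)ᴴ * K.submatrix f f).PosSemidef := by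
  classical
  let L : Matrix {r // r ∉ Set.range f} k ℂ := K.submatrix Subtype.val f
  have hsplit (F : n → ℂ) :
      (∑ j, F (f j)) + ∑ r : {r // r ∉ Set.range f}, F r.1 = ∑ r, F r := by
    rw [← Fintype.sum_subtype_add_sum_subtype (· ∈ Set.range f) F,
      Fintype.sum_equiv (Equiv.ofInjective f hf) (fun j => F (f j)) (fun r => F r.1) fun _ => rfl]
    congr!
  have hL : (Kᴴ * K).submatrix f f - (K.submatrix f f)ᴴ * K.submatrix f f = Lᴴ * L := by
    ext e e'
    simp only [Matrix.sub_apply, submatrix_apply, Matrix.mul_apply, conjTranspose_apply, L]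
    rw [sub_eq_iff_eq_add', hsplit fun r => star (K r (f e)) * K r (f e')]
  rw [hL]
  exact posSemidef_conjTranspose_mul_self L

lemma neg_sin_mul_pi_div_pi_nonneg (hα : α ∈ Set.Ioo (1 : ℝ) 2) :
    0 ≤ -(Real.sin (α * Real.pi) / Real.pi) :=
  neg_nonneg.2 (div_neg_of_neg_of_pos (sin_mul_pi_neg hα) Real.pi_pos).le

lemma posSemidef_neg_quadratureQ (hα : α ∈ Set.Ioo (1 : ℝ) 2) (hw : ∀ i, 0 ≤ w i)
    (Z : Fin m → Matrix n n ℂ) : (-quadratureQ α w Z).PosSemidef := by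
  rw [quadratureQ, ← neg_smul]
  exact (posSemidef_sum _ fun i _ => (posSemidef_self_mul_conjTranspose (Z i)).smul (hw i)).smul
    (neg_sin_mul_pi_div_pi_nonneg hα)

lemma posSemidef_quadratureQ_submatrix_sub (hα : α ∈ Set.Ioo (1 : ℝ) 2) (hw : ∀ i, 0 ≤ w i)
    (Z : Fin m → Matrix n n ℂ) {f : k → n} (hf : Function.Injective f) :
    (quadratureQ α w (fun i => (Z i).submatrix f f) -
      (quadratureQ α w Z).submatrix f f).PosSemidef := by
  have hdiff : quadratureQ α w (fun i => (Z i).submatrix f f) - (quadratureQ α w Z).submatrix f f =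
      (-(Real.sin (α * Real.pi) / Real.pi)) • ∑ i, w i • ((Z i * (Z i)ᴴ).submatrix f f -
        (Z i).submatrix f f * ((Z i).submatrix f f)ᴴ) := by
    ext e e'
    simp only [quadratureQ, Matrix.sub_apply, Matrix.smul_apply, Matrix.sum_apply, submatrix_apply,
      smul_sub, Finset.sum_sub_distrib, neg_smul]
    abel
  rw [hdiff]
  refine (posSemidef_sum _ fun i _ => PosSemidef.smul ?_ (hw i)).smul
    (neg_sin_mul_pi_div_pi_nonneg hα)
  simpa only [conjTranspose_submatrix, conjTranspose_conjTranspose] using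
    posSemidef_submatrix_sub (Z i)ᴴ hf

lemma posSemidef_quadratureP_submatrix_sub [DecidableEq n] [DecidableEq k]
    (hα : α ∈ Set.Ioo (1 : ℝ) 2) (ht : ∀ i, t i ∈ Set.Ioc 0 1) (hw : ∀ i, 0 ≤ w i)
    (Z : Fin m → Matrix n n ℂ) {f : k → n} (hf : Function.Injective f) :
    (quadratureP α t w (fun i => (Z i).submatrix f f) -
      (quadratureP α t w Z).submatrix f f).PosSemidef := by
  have hdiff : quadratureP α t w (fun i => (Z i).submatrix f f) -
      (quadratureP α t w Z).submatrix f f =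
        (-(Real.sin (α * Real.pi) / Real.pi)) • ∑ i, (w i / t i * (1 - t i)) •
          (((Z i)ᴴ * Z i).submatrix f f - ((Z i).submatrix f f)ᴴ * (Z i).submatrix f f) := by
    ext e e'
    simp only [quadratureP, Matrix.sub_apply, Matrix.add_apply, Matrix.smul_apply,
      Matrix.sum_apply, submatrix_apply, conjTranspose_submatrix, one_apply, hf.eq_iff, smul_sub,
      smul_add, Finset.sum_sub_distrib, Finset.sum_add_distrib, neg_smul, smul_smul]
    abel
  rw [hdiff]
  exact (posSemidef_sum _ fun i _ => (posSemidef_submatrix_sub (Z i) hf).smul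
    (mul_nonneg (div_nonneg (hw i) (ht i).1.le) (sub_nonneg.2 (ht i).2))).smul
    (neg_sin_mul_pi_div_pi_nonneg hα)

lemma re_trace_mul_le_of_posSemidef_sub {τ K K' : Matrix n n ℂ} (hτ : τ.PosSemidef)
    (hK : (K' - K).PosSemidef) : (τ * K).trace.re ≤ (τ * K').trace.re := by
  have hnonneg := re_trace_mul_nonneg hτ hK
  rwa [mul_sub, trace_sub, Complex.sub_re, sub_nonneg] at hnonneg

end Compression

section PartialTrace

open Matrix

lemma kronecker_finsetSum {l m n p ι : Type*} (s : Finset ι) (A : Matrix l m ℂ)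
    (B : ι → Matrix n p ℂ) : A ⊗ₖ (∑ i ∈ s, B i) = ∑ i ∈ s, A ⊗ₖ B i := by
  ext; simp [Matrix.sum_apply, Finset.mul_sum]

lemma finsetSum_kronecker {l m n p ι : Type*} (s : Finset ι) (A : ι → Matrix l m ℂ)
    (B : Matrix n p ℂ) : (∑ i ∈ s, A i) ⊗ₖ B = ∑ i ∈ s, A i ⊗ₖ B := by
  ext; simp [Matrix.sum_apply, Finset.sum_mul]

variable {dA dB dE : ℕ}

/-- The partial trace over `Q_A Q_B` as a linear map. -/
noncomputable def traceOutABₗ : Matrix (Fin dA × Fin dB × Fin dE) (Fin dA × Fin dB × Fin dE) ℂ →ₗ[ℂ]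
    Matrix (Fin dE) (Fin dE) ℂ where
  toFun := traceOutAB
  map_add' σ τ := by ext; simp [traceOutAB, Finset.sum_add_distrib]
  map_smul' c σ := by ext; simp [traceOutAB, Finset.mul_sum]

lemma trace_one_kronecker_mul (C : Matrix (Fin dE) (Fin dE) ℂ)
    (τ : Matrix (Fin dA × Fin dB × Fin dE) (Fin dA × Fin dB × Fin dE) ℂ) :
    (((1 : Matrix (Fin dA) (Fin dA) ℂ) ⊗ₖ ((1 : Matrix (Fin dB) (Fin dB) ℂ) ⊗ₖ C)) * τ).trace =
      (traceOutAB τ * C).trace := by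
  rw [trace_mul_comm (traceOutAB τ)]
  simp only [Matrix.trace, Matrix.diag, Matrix.mul_apply, Fintype.sum_prod_type, kronecker_apply,
    one_apply, traceOutAB, ite_mul, one_mul, zero_mul, Finset.sum_ite_eq, Finset.mem_univ, if_true,
    Finset.sum_const_zero, Finset.mul_sum, Finset.sum_ite_irrel]
  refine (Finset.sum_congr rfl fun _ _ => Finset.sum_comm).trans ?_
  rw [Finset.sum_comm]
  refine Finset.sum_congr rfl fun e _ => ?_
  exact (Finset.sum_congr rfl fun _ _ => Finset.sum_comm).trans Finset.sum_comm

lemma trace_traceOutAB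
    (τ : Matrix (Fin dA × Fin dB × Fin dE) (Fin dA × Fin dB × Fin dE) ℂ) :
    (traceOutAB τ).trace = τ.trace := by
  simpa only [mul_one, one_kronecker_one, one_mul, eq_comm] using trace_one_kronecker_mul 1 τ

lemma trace_traceOutAB_mul (A : Matrix (Fin dA) (Fin dA) ℂ) (B : Matrix (Fin dB) (Fin dB) ℂ)
    (C : Matrix (Fin dE) (Fin dE) ℂ)
    (σ : Matrix (Fin dA × Fin dB × Fin dE) (Fin dA × Fin dB × Fin dE) ℂ) :
    (traceOutAB ((A ⊗ₖ (B ⊗ₖ (1 : Matrix (Fin dE) (Fin dE) ℂ))) * σ) * C).trace =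
      ((A ⊗ₖ (B ⊗ₖ C)) * σ).trace := by
  rw [← trace_one_kronecker_mul, ← mul_assoc, ← mul_kronecker_mul, ← mul_kronecker_mul, one_mul,
    one_mul, mul_one]

lemma traceOutAB_mul_comm (A : Matrix (Fin dA) (Fin dA) ℂ) (B : Matrix (Fin dB) (Fin dB) ℂ)
    (σ : Matrix (Fin dA × Fin dB × Fin dE) (Fin dA × Fin dB × Fin dE) ℂ) :
    traceOutAB ((A ⊗ₖ (B ⊗ₖ (1 : Matrix (Fin dE) (Fin dE) ℂ))) * σ) =
      traceOutAB (σ * (A ⊗ₖ (B ⊗ₖ (1 : Matrix (Fin dE) (Fin dE) ℂ)))) := by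
  refine Matrix.ext_iff_trace_mul_right.2 fun C => ?_
  rw [← trace_one_kronecker_mul, ← trace_one_kronecker_mul, ← mul_assoc, ← mul_assoc,
    trace_mul_comm (_ * σ), ← mul_assoc, ← mul_kronecker_mul, ← mul_kronecker_mul,
    ← mul_kronecker_mul, ← mul_kronecker_mul]
  simp only [one_mul, mul_one]

lemma posSemidef_traceOutAB
    {τ : Matrix (Fin dA × Fin dB × Fin dE) (Fin dA × Fin dB × Fin dE) ℂ} (hτ : τ.PosSemidef) :
    (traceOutAB τ).PosSemidef := by
  have hsum : traceOutAB τ =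
      ∑ i, ∑ j, τ.submatrix (fun e => (i, j, e)) (fun e => (i, j, e)) := by
    ext; simp [traceOutAB, Matrix.sum_apply]
  rw [hsum]
  exact posSemidef_sum _ fun i _ => posSemidef_sum _ fun j _ => hτ.submatrix _

lemma posSemidef_traceOutAB_mul {A : Matrix (Fin dA) (Fin dA) ℂ} {B : Matrix (Fin dB) (Fin dB) ℂ}
    {σ : Matrix (Fin dA × Fin dB × Fin dE) (Fin dA × Fin dB × Fin dE) ℂ}
    (hA : A.PosSemidef) (hB : B.PosSemidef) (hσ : σ.PosSemidef) :
    (traceOutAB ((A ⊗ₖ (B ⊗ₖ (1 : Matrix (Fin dE) (Fin dE) ℂ))) * σ)).PosSemidef := by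
  obtain ⟨a, rfl⟩ := exists_eq_conjTranspose_mul_self hA
  obtain ⟨b, rfl⟩ := exists_eq_conjTranspose_mul_self hB
  have hmul : (aᴴ * a) ⊗ₖ ((bᴴ * b) ⊗ₖ (1 : Matrix (Fin dE) (Fin dE) ℂ)) =
      (aᴴ ⊗ₖ (bᴴ ⊗ₖ (1 : Matrix (Fin dE) (Fin dE) ℂ))) *
        (a ⊗ₖ (b ⊗ₖ (1 : Matrix (Fin dE) (Fin dE) ℂ))) := by
    rw [← mul_kronecker_mul, ← mul_kronecker_mul, one_mul]
  have hadj : aᴴ ⊗ₖ (bᴴ ⊗ₖ (1 : Matrix (Fin dE) (Fin dE) ℂ)) =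
      (a ⊗ₖ (b ⊗ₖ (1 : Matrix (Fin dE) (Fin dE) ℂ)))ᴴ := by
    rw [conjTranspose_kronecker, conjTranspose_kronecker, conjTranspose_one]
  rw [hmul, mul_assoc, traceOutAB_mul_comm, hadj]
  exact posSemidef_traceOutAB (hσ.mul_mul_conjTranspose_same _)

end PartialTrace

section Device

open Matrix

namespace Protocol

variable {X Y A B C : Type*} [Fintype X] [Fintype Y] {P : Protocol X Y A B C} {dA dB dE : ℕ}

/-- The unnormalised state of the environment when Alice obtains `a` on input `x`. -/
noncomputable def aliceState (𝒟 : P.Device dA dB) (σ : NormalizedState dA dB dE) (x : X)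
    (a : P.outA x) : Matrix (Fin dE) (Fin dE) ℂ :=
  traceOutAB ((𝒟.M x a ⊗ₖ ((1 : Matrix (Fin dB) (Fin dB) ℂ) ⊗ₖ
    (1 : Matrix (Fin dE) (Fin dE) ℂ))) * σ.1)

lemma posSemidef_aliceState (𝒟 : P.Device dA dB) (σ : NormalizedState dA dB dE) (x : X)
    (a : P.outA x) : (aliceState 𝒟 σ x a).PosSemidef :=
  posSemidef_traceOutAB_mul (𝒟.M_pos x a) PosSemidef.one σ.2.1

lemma sum_aliceState (𝒟 : P.Device dA dB) (σ : NormalizedState dA dB dE) (x : X) :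
    ∑ a, aliceState 𝒟 σ x a = traceOutAB σ.1 := by
  refine (map_sum traceOutABₗ _ _).symm.trans ?_
  rw [← Finset.sum_mul, ← finsetSum_kronecker, 𝒟.M_sum, one_kronecker_one,
    one_kronecker_one, one_mul]
  rfl

lemma posSemidef_traceOutAB_sub_aliceState (𝒟 : P.Device dA dB) (σ : NormalizedState dA dB dE)
    (x : X) (a : P.outA x) : (traceOutAB σ.1 - aliceState 𝒟 σ x a).PosSemidef := by
  classical
  rw [← sum_aliceState 𝒟 σ x, ← Finset.add_sum_erase _ _ (Finset.mem_univ a), add_sub_cancel_left]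
  exact posSemidef_sum _ fun b _ => posSemidef_aliceState 𝒟 σ x b

lemma sum_traceOutAB (𝒟 : P.Device dA dB) (σ : NormalizedState dA dB dE) (x : X) (a : P.outA x)
    (y : Y) : ∑ b, traceOutAB ((𝒟.M x a ⊗ₖ (𝒟.N y b ⊗ₖ (1 : Matrix (Fin dE) (Fin dE) ℂ))) * σ.1) =
      aliceState 𝒟 σ x a := by
  refine (map_sum traceOutABₗ _ _).symm.trans ?_
  rw [← Finset.sum_mul, ← kronecker_finsetSum, ← finsetSum_kronecker, 𝒟.N_sum]
  rfl

lemma sum_inputProb (P : Protocol X Y A B C) : ∑ x, ∑ y, ∑ t, P.inputProb x y t = 1 := by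
  have hkey := P.keyDist_mem.2
  have htest := P.testDist_mem.2
  rw [Fintype.sum_prod_type] at hkey htest
  simp only [inputProb, Fintype.sum_bool, if_true, Bool.false_eq_true, if_false,
    Finset.sum_add_distrib, ← Finset.mul_sum, hkey, htest]
  ring

lemma sum_keyProb (P : Protocol X Y A B C) : ∑ x, P.keyProb x = 1 := by
  have hsum := P.keyDist_mem.2
  rwa [Fintype.sum_prod_type] at hsum

lemma keyProb_nonneg (P : Protocol X Y A B C) (x : X) : 0 ≤ P.keyProb x :=
  Finset.sum_nonneg fun _ _ => P.keyDist_mem.1 _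

lemma keyProb_eq_zero (P : Protocol X Y A B C) {x : X} (hx : x ∉ P.keyX) : P.keyProb x = 0 :=
  Finset.sum_eq_zero fun y _ => by
    by_contra h
    exact hx (P.keyDist_support x y h).1

end Protocol

end Device

section ClassicalBlock

open Matrix

variable {X Y A C : Type*} [DecidableEq X] [DecidableEq A] {dE : ℕ}

/-- The operator `|a, x⟩⟨a, x| ⊗ τ`, linear in `τ`. -/
noncomputable def classicalBlock (a : A) (x : X) :
    Matrix (Fin dE) (Fin dE) ℂ →ₗ[ℂ] Matrix (A × (X × Fin dE)) (A × (X × Fin dE)) ℂ where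
  toFun τ := single a a (1 : ℂ) ⊗ₖ (single x x (1 : ℂ) ⊗ₖ τ)
  map_add' σ τ := by rw [kronecker_add, kronecker_add]
  map_smul' c τ := by rw [kronecker_smul, kronecker_smul, RingHom.id_apply]

/-- The block `⟨a, x| K |a, x⟩` of an operator on the registers `A`, `X` and the environment. -/
def registerBlock (a : A) (x : X) (K : Matrix (A × (X × Fin dE)) (A × (X × Fin dE)) ℂ) :
    Matrix (Fin dE) (Fin dE) ℂ :=
  K.submatrix (fun e => (a, x, e)) fun e => (a, x, e)

lemma classicalBlock_apply (a : A) (x : X) (τ : Matrix (Fin dE) (Fin dE) ℂ) :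
    classicalBlock a x τ = single a a (1 : ℂ) ⊗ₖ (single x x (1 : ℂ) ⊗ₖ τ) := rfl

lemma posSemidef_single_one {n : Type*} [DecidableEq n] (i : n) :
    (single i i (1 : ℂ)).PosSemidef := by
  rw [← diagonal_single]
  exact PosSemidef.diagonal (Pi.single_nonneg.2 zero_le_one)

lemma posSemidef_classicalBlock [Finite X] [Finite A] (a : A) (x : X)
    {τ : Matrix (Fin dE) (Fin dE) ℂ} (hτ : τ.PosSemidef) : (classicalBlock a x τ).PosSemidef :=
  (posSemidef_single_one a).kronecker ((posSemidef_single_one x).kronecker hτ)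

lemma trace_classicalBlock_mul [Fintype X] [Fintype A] (a : A) (x : X)
    (τ : Matrix (Fin dE) (Fin dE) ℂ) (K : Matrix (A × (X × Fin dE)) (A × (X × Fin dE)) ℂ) :
    (classicalBlock a x τ * K).trace = (τ * registerBlock a x K).trace := by
  simp only [classicalBlock_apply, registerBlock, Matrix.trace, Matrix.diag, Matrix.mul_apply,
    Fintype.sum_prod_type, kronecker_apply, single_apply, submatrix_apply]
  rw [Fintype.sum_eq_single a, Fintype.sum_eq_single x]
  · refine Finset.sum_congr rfl fun e _ => ?_
    rw [Fintype.sum_eq_single a, Fintype.sum_eq_single x]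
    · simp
    · intro x' hx'; simp [hx'.symm]
    · intro a' ha'; simp [ha'.symm]
  · intro x' hx'; simp [hx'.symm]
  · intro a' ha'; simp [ha'.symm]

lemma trace_classicalBlock [Fintype X] [Fintype A] (a : A) (x : X)
    (τ : Matrix (Fin dE) (Fin dE) ℂ) : (classicalBlock a x τ).trace = τ.trace := by
  simp [classicalBlock_apply, trace_kronecker]

lemma reduceRight_classicalBlock [Fintype A] (a : A) (x : X) (τ : Matrix (Fin dE) (Fin dE) ℂ) :
    reduceRight (classicalBlock a x τ) = single x x (1 : ℂ) ⊗ₖ τ := by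
  ext i j
  simp [reduceRight, classicalBlock_apply, single_apply]

lemma reduceAXE_partialKey_single [Fintype Y] [DecidableEq Y] [Fintype C] [DecidableEq C]
    (a : A) (c : Option C) (x : X) (y : Y) (t : Bool) (τ : Matrix (Fin dE) (Fin dE) ℂ) :
    reduceAXE (partialKey (single (a, c, x, y, t) (a, c, x, y, t) (1 : ℂ) ⊗ₖ τ)) =
      if t = false then classicalBlock a x τ else 0 := by
  ext ⟨a₁, x₁, e₁⟩ ⟨a₂, x₂, e₂⟩
  simp only [reduceAXE, partialKey, kronecker_apply, single_apply, Prod.mk.injEq]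
  rw [Fintype.sum_eq_single c, Fintype.sum_eq_single y, Fintype.sum_eq_single t]
  · cases t with
    | false =>
      by_cases h₁ : a = a₁ ∧ x = x₁ <;> by_cases h₂ : a = a₂ ∧ x = x₂ <;>
        simp [classicalBlock_apply, single_apply, and_comm] <;> grind
    | true => simp
  · intro t' ht'; simp [ht'.symm]
  · intro y' hy'; simp [hy'.symm]
  · intro c' hc'; simp [hc'.symm]

lemma testDataDist_single [Fintype X] [Fintype Y] [DecidableEq Y] [Fintype A] [DecidableEq C]
    (a : A) (c c' : Option C) (x : X) (y : Y) (t : Bool) (τ : Matrix (Fin dE) (Fin dE) ℂ) :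
    testDataDist (single (a, c, x, y, t) (a, c, x, y, t) (1 : ℂ) ⊗ₖ τ) c' =
      if c = c' then τ.trace.re else 0 := by
  simp only [testDataDist, kronecker_apply, single_apply, Prod.mk.injEq]
  rw [Fintype.sum_eq_single a, Fintype.sum_eq_single x, Fintype.sum_eq_single y,
    Fintype.sum_eq_single t]
  · by_cases hc : c = c' <;> simp [hc, Matrix.trace, Complex.re_sum]
  · intro t' ht'; simp [ht'.symm]
  · intro y' hy'; simp [hy'.symm]
  · intro x' hx'; simp [hx'.symm]
  · intro a' ha'; simp [ha'.symm]

end ClassicalBlock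

/-! ### The entropy of a round -/

section ReductionMaps

open Matrix

variable {X Y A C : Type*} {dE : ℕ}

/-- Restriction to the event `T = 0` as a linear map. -/
def partialKeyₗ :
    Matrix (ClassicalReg X Y A C × Fin dE) (ClassicalReg X Y A C × Fin dE) ℂ →ₗ[ℂ]
      Matrix (ClassicalReg X Y A C × Fin dE) (ClassicalReg X Y A C × Fin dE) ℂ where
  toFun := partialKey
  map_add' ρ τ := by ext; simp only [partialKey, Matrix.add_apply]; split_ifs <;> simp
  map_smul' c ρ := by ext; simp only [partialKey, Matrix.smul_apply]; split_ifs <;> simp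

/-- Reduction to the registers `A` and `X E` as a linear map. -/
def reduceAXEₗ [Fintype Y] [Fintype C] :
    Matrix (ClassicalReg X Y A C × Fin dE) (ClassicalReg X Y A C × Fin dE) ℂ →ₗ[ℂ]
      Matrix (A × (X × Fin dE)) (A × (X × Fin dE)) ℂ where
  toFun := reduceAXE
  map_add' ρ τ := by ext; simp [reduceAXE, Finset.sum_add_distrib]
  map_smul' c ρ := by
    ext
    simp only [reduceAXE, Matrix.smul_apply, smul_eq_mul, Finset.mul_sum, RingHom.id_apply]

/-- The reduced state on the second factor as a linear map. -/
def reduceRightₗ {n k : Type*} [Fintype n] : Matrix (n × k) (n × k) ℂ →ₗ[ℂ] Matrix k k ℂ where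
  toFun := reduceRight
  map_add' ρ τ := by ext; simp [reduceRight, Finset.sum_add_distrib]
  map_smul' c ρ := by ext; simp [reduceRight, Finset.mul_sum]

/-- The weight of a value of the test data as a linear map. -/
def testDataDistₗ [Fintype X] [Fintype Y] [Fintype A] (c : Option C) :
    Matrix (ClassicalReg X Y A C × Fin dE) (ClassicalReg X Y A C × Fin dE) ℂ →ₗ[ℝ] ℝ where
  toFun ρ := testDataDist ρ c
  map_add' ρ τ := by simp [testDataDist, Finset.sum_add_distrib]
  map_smul' r ρ := by
    simp only [testDataDist, Matrix.smul_apply, Complex.smul_re, smul_eq_mul, Finset.mul_sum,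
      RingHom.id_apply]

end ReductionMaps

section KeyState

open Matrix

namespace Protocol

variable {X Y A B C : Type*} [Fintype X] [Fintype Y] {P : Protocol X Y A B C} {dA dB dE : ℕ}

lemma posSemidef_keyProb_smul {n : Type*} (x : X) {τ : Matrix n n ℂ} (hτ : τ.PosSemidef) :
    ((P.keyProb x : ℂ) • τ).PosSemidef :=
  hτ.smul (by exact_mod_cast P.keyProb_nonneg x)

variable [DecidableEq X] [DecidableEq A]

/-- The state of the registers `A`, `X` and the environment given `T = 0`. -/
noncomputable def keyState (𝒟 : P.Device dA dB) (σ : NormalizedState dA dB dE) :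
    Matrix (A × (X × Fin dE)) (A × (X × Fin dE)) ℂ :=
  ∑ x, (P.keyProb x : ℂ) • ∑ a : P.outA x, classicalBlock a.1 x (aliceState 𝒟 σ x a)

lemma trace_keyState [Fintype A] (𝒟 : P.Device dA dB) (σ : NormalizedState dA dB dE) :
    (keyState 𝒟 σ).trace = 1 := by
  simp only [keyState, trace_sum, trace_smul, trace_classicalBlock]
  simp only [← trace_sum, sum_aliceState, trace_traceOutAB, σ.2.2, smul_eq_mul, mul_one]
  exact_mod_cast P.sum_keyProb

lemma re_trace_keyState_mul [Fintype A] (𝒟 : P.Device dA dB) (σ : NormalizedState dA dB dE)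
    (K : Matrix (A × (X × Fin dE)) (A × (X × Fin dE)) ℂ) :
    (keyState 𝒟 σ * K).trace.re =
      ∑ x, P.keyProb x * ∑ a : P.outA x, (aliceState 𝒟 σ x a * registerBlock a.1 x K).trace.re := by
  simp only [keyState, Finset.sum_mul, smul_mul_assoc, trace_sum, trace_smul,
    trace_classicalBlock_mul, Complex.re_sum, smul_eq_mul, Complex.re_ofReal_mul]

lemma posSemidef_keyState [Finite A] (𝒟 : P.Device dA dB) (σ : NormalizedState dA dB dE) :
    (keyState 𝒟 σ).PosSemidef :=
  posSemidef_sum _ fun x _ => posSemidef_keyProb_smul x <| posSemidef_sum _ fun a _ =>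
    posSemidef_classicalBlock a.1 x (posSemidef_aliceState 𝒟 σ x a)

lemma one_kronecker_reduceRight_keyState [Fintype A] (𝒟 : P.Device dA dB)
    (σ : NormalizedState dA dB dE) :
    (1 : Matrix A A ℂ) ⊗ₖ reduceRight (keyState 𝒟 σ) =
      ∑ x, (P.keyProb x : ℂ) • ∑ a : A, classicalBlock a x (traceOutAB σ.1) := by
  have hreduce : reduceRight (keyState 𝒟 σ) =
      ∑ x, (P.keyProb x : ℂ) • (single x x (1 : ℂ) ⊗ₖ traceOutAB σ.1) := by
    change reduceRightₗ (keyState 𝒟 σ) = _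
    simp only [keyState, map_sum, map_smul]
    simp only [reduceRightₗ, LinearMap.coe_mk, AddHom.coe_mk, reduceRight_classicalBlock,
      ← kronecker_finsetSum, sum_aliceState]
  rw [hreduce, kronecker_finsetSum]
  refine Finset.sum_congr rfl fun x _ => ?_
  rw [kronecker_smul, ← sum_single_one, finsetSum_kronecker]
  rfl

lemma re_trace_one_kronecker_reduceRight_keyState_mul [Fintype A] (𝒟 : P.Device dA dB)
    (σ : NormalizedState dA dB dE) (K : Matrix (A × (X × Fin dE)) (A × (X × Fin dE)) ℂ) :
    (((1 : Matrix A A ℂ) ⊗ₖ reduceRight (keyState 𝒟 σ)) * K).trace.re =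
      ∑ x, P.keyProb x * ∑ a : A, (traceOutAB σ.1 * registerBlock a x K).trace.re := by
  rw [one_kronecker_reduceRight_keyState]
  simp only [Finset.sum_mul, smul_mul_assoc, trace_sum, trace_smul, trace_classicalBlock_mul,
    Complex.re_sum, smul_eq_mul, Complex.re_ofReal_mul]

lemma posSemidef_one_kronecker_reduceRight_sub_keyState [Fintype A] (𝒟 : P.Device dA dB)
    (σ : NormalizedState dA dB dE) :
    ((1 : Matrix A A ℂ) ⊗ₖ reduceRight (keyState 𝒟 σ) - keyState 𝒟 σ).PosSemidef := by
  rw [one_kronecker_reduceRight_keyState, keyState, ← Finset.sum_sub_distrib]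
  refine posSemidef_sum _ fun x _ => ?_
  rw [← smul_sub]
  refine posSemidef_keyProb_smul x ?_
  rw [← Finset.sum_add_sum_compl (P.outA x), ← Finset.sum_coe_sort (P.outA x), add_sub_right_comm,
    ← Finset.sum_sub_distrib]
  refine PosSemidef.add (posSemidef_sum _ fun a _ => ?_) (posSemidef_sum _ fun a _ => ?_)
  · rw [← map_sub]
    exact posSemidef_classicalBlock _ _ (posSemidef_traceOutAB_sub_aliceState 𝒟 σ x a)
  · exact posSemidef_classicalBlock _ _ (posSemidef_traceOutAB σ.2.1)

lemma posSemidef_one_kronecker_reduceRight_keyState [Fintype A] (𝒟 : P.Device dA dB)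
    (σ : NormalizedState dA dB dE) :
    ((1 : Matrix A A ℂ) ⊗ₖ reduceRight (keyState 𝒟 σ)).PosSemidef := by
  simpa only [sub_add_cancel] using
    (posSemidef_one_kronecker_reduceRight_sub_keyState 𝒟 σ).add (posSemidef_keyState 𝒟 σ)

lemma keyState_mulVec_eq_zero [Fintype A] (𝒟 : P.Device dA dB) (σ : NormalizedState dA dB dE)
    (v : A × (X × Fin dE) → ℂ)
    (hv : ((1 : Matrix A A ℂ) ⊗ₖ reduceRight (keyState 𝒟 σ)) *ᵥ v = 0) :
    keyState 𝒟 σ *ᵥ v = 0 := by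
  have hle := (posSemidef_one_kronecker_reduceRight_sub_keyState 𝒟 σ).dotProduct_mulVec_nonneg v
  rw [sub_mulVec, hv, zero_sub, dotProduct_neg, neg_nonneg] at hle
  have hpos := posSemidef_keyState 𝒟 σ
  exact (hpos.dotProduct_mulVec_zero_iff v).1 (hle.antisymm (hpos.dotProduct_mulVec_nonneg v))

end Protocol

end KeyState

section RoundOutput

open Matrix

variable {X Y A B C : Type*} [Fintype X] [Fintype Y]

lemma trace_reduceAXE [Fintype A] [Fintype C] {dE : ℕ}
    (ρ : Matrix (ClassicalReg X Y A C × Fin dE) (ClassicalReg X Y A C × Fin dE) ℂ) :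
    (reduceAXE ρ).trace = ρ.trace := by
  let e : (A × (X × Fin dE)) × (Option C × Y × Bool) ≃ ClassicalReg X Y A C × Fin dE :=
    { toFun := fun r => ((r.1.1, r.2.1, r.1.2.1, r.2.2.1, r.2.2.2), r.1.2.2)
      invFun := fun r => ((r.1.1, r.1.2.2.1, r.2), (r.1.2.1, r.1.2.2.2.1, r.1.2.2.2.2))
      left_inv := fun _ => rfl
      right_inv := fun _ => rfl }
  have he : ∑ r, ρ (e r) (e r) = ρ.trace := Fintype.sum_equiv e _ _ fun _ => rfl
  simp only [← he, Fintype.sum_prod_type (α₁ := A × (X × Fin dE)),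
    Fintype.sum_prod_type (α₁ := Option C), Fintype.sum_prod_type (α₁ := Y)]
  rfl

namespace Protocol

variable [DecidableEq X] [DecidableEq Y] [DecidableEq A] [DecidableEq C]
  {P : Protocol X Y A B C} {dA dB dE : ℕ}

lemma trace_roundOutput [Fintype A] [Fintype C] (𝒟 : P.Device dA dB)
    (σ : NormalizedState dA dB dE) :
    (P.roundOutput 𝒟 σ).trace = 1 := by
  simp only [roundOutput, trace_sum, trace_smul, trace_kronecker, trace_single_eq_same, one_mul,
    ← Finset.smul_sum]
  simp only [← trace_sum, sum_traceOutAB, sum_aliceState]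
  simp only [trace_traceOutAB, σ.2.2, smul_eq_mul, mul_one]
  exact_mod_cast P.sum_inputProb

lemma reduceAXE_partialKey_roundOutput [Fintype C] (𝒟 : P.Device dA dB)
    (σ : NormalizedState dA dB dE) :
    reduceAXE (partialKey (P.roundOutput 𝒟 σ)) = ((1 - P.γ : ℝ) : ℂ) • keyState 𝒟 σ := by
  change (reduceAXEₗ ∘ₗ partialKeyₗ) (P.roundOutput 𝒟 σ) = _
  rw [roundOutput]
  simp only [map_sum, map_smul, LinearMap.comp_apply]
  simp only [reduceAXEₗ, partialKeyₗ, LinearMap.coe_mk, AddHom.coe_mk,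
    reduceAXE_partialKey_single, Fintype.sum_bool, Bool.true_eq_false, if_false, if_true, smul_zero,
    Finset.sum_const_zero, zero_add, ← Finset.smul_sum, ← map_sum, sum_traceOutAB]
  rw [keyState, Finset.smul_sum]
  refine Finset.sum_congr rfl fun x _ => ?_
  rw [← Finset.sum_smul, smul_smul]
  congr 1
  simp [inputProb, keyProb, Finset.mul_sum]

lemma reduceAXE_conditionKey_roundOutput [Fintype A] [Fintype C] (𝒟 : P.Device dA dB)
    (σ : NormalizedState dA dB dE) :
    reduceAXE (conditionKey (P.roundOutput 𝒟 σ)) = keyState 𝒟 σ := by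
  have htr : (partialKey (P.roundOutput 𝒟 σ)).trace = ((1 - P.γ : ℝ) : ℂ) := by
    rw [← trace_reduceAXE, reduceAXE_partialKey_roundOutput, trace_smul, trace_keyState,
      smul_eq_mul, mul_one]
  have hγ : ((1 - P.γ : ℝ) : ℂ) ≠ 0 := by
    exact_mod_cast (sub_pos.2 P.γ_lt_one).ne'
  rw [conditionKey, trace_roundOutput, htr]
  refine (map_smul reduceAXEₗ _ _).trans ?_
  change _ • reduceAXE (partialKey (P.roundOutput 𝒟 σ)) = _
  rw [reduceAXE_partialKey_roundOutput, smul_smul, one_div, inv_mul_cancel₀ hγ, one_smul]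

lemma testDataDist_roundOutput [Fintype A] (𝒟 : P.Device dA dB)
    (σ : NormalizedState dA dB dE) (c : Option C) :
    testDataDist (P.roundOutput 𝒟 σ) c = ∑ x, ∑ y, ∑ t, ∑ a : P.outA x, ∑ b : P.outB y,
      P.inputProb x y t * if P.testData a.1 b.1 x y t = c then
        ((𝒟.M x a ⊗ₖ (𝒟.N y b ⊗ₖ (1 : Matrix (Fin dE) (Fin dE) ℂ))) * σ.1).trace.re else 0 := by
  change testDataDistₗ c (P.roundOutput 𝒟 σ) = _
  simp only [roundOutput, Complex.coe_smul, map_sum, map_smul, smul_eq_mul]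
  simp only [testDataDistₗ, LinearMap.coe_mk, AddHom.coe_mk, testDataDist_single, trace_traceOutAB]

end Protocol

end RoundOutput

section KeyEntropy

open Matrix

namespace Protocol

variable {X Y A B C : Type*} [Fintype X] [DecidableEq X] [Fintype Y] [Fintype A] [DecidableEq A]
  {P : Protocol X Y A B C} {dA dB dE m : ℕ} {α : ℝ} {t w : Fin m → ℝ}

lemma injective_prodMk_prodMk {α β γ : Type*} (a : α) (b : β) :
    Function.Injective fun c : γ => (a, b, c) :=
  (Prod.mk_right_injective a).comp (Prod.mk_right_injective b)

lemma quadratureTrace_keyState_le (hα : α ∈ Set.Ioo (1 : ℝ) 2) (ht : ∀ i, t i ∈ Set.Ioc 0 1)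
    (hw : ∀ i, 0 ≤ w i) (𝒟 : P.Device dA dB) (σ : NormalizedState dA dB dE)
    (Z : Fin m → Matrix (A × (X × Fin dE)) (A × (X × Fin dE)) ℂ) :
    quadratureTrace α t w (keyState 𝒟 σ) ((1 : Matrix A A ℂ) ⊗ₖ reduceRight (keyState 𝒟 σ)) Z ≤
      ∑ x, P.keyProb x * ∑ a : P.outA x,
        quadratureTrace α t w (aliceState 𝒟 σ x a) (traceOutAB σ.1)
          fun i => registerBlock a.1 x (Z i) := by
  have hE := posSemidef_traceOutAB σ.2.1
  have hP (x : X) (a : P.outA x) :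
      (aliceState 𝒟 σ x a * registerBlock a.1 x (quadratureP α t w Z)).trace.re ≤
        (aliceState 𝒟 σ x a * quadratureP α t w fun i => registerBlock a.1 x (Z i)).trace.re :=
    re_trace_mul_le_of_posSemidef_sub (posSemidef_aliceState 𝒟 σ x a)
      (posSemidef_quadratureP_submatrix_sub hα ht hw Z (injective_prodMk_prodMk a.1 x))
  have hQ (x : X) (a : A) : (traceOutAB σ.1 * registerBlock a x (quadratureQ α w Z)).trace.re ≤
      (traceOutAB σ.1 * quadratureQ α w fun i => registerBlock a x (Z i)).trace.re :=
    re_trace_mul_le_of_posSemidef_sub hE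
      (posSemidef_quadratureQ_submatrix_sub hα hw Z (injective_prodMk_prodMk a x))
  have hQ_nonpos (x : X) (a : A) :
      (traceOutAB σ.1 * registerBlock a x (quadratureQ α w Z)).trace.re ≤ 0 := by
    have hneg := re_trace_mul_nonneg hE
      ((posSemidef_neg_quadratureQ hα hw Z).submatrix fun e => (a, x, e))
    simpa [registerBlock, Matrix.submatrix_neg] using hneg
  rw [quadratureTrace, re_trace_keyState_mul, re_trace_one_kronecker_reduceRight_keyState_mul,
    ← Finset.sum_add_distrib]
  refine Finset.sum_le_sum fun x _ => ?_
  rw [← mul_add]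
  refine mul_le_mul_of_nonneg_left ?_ (P.keyProb_nonneg x)
  simp only [quadratureTrace, Finset.sum_add_distrib]
  refine add_le_add (Finset.sum_le_sum fun a _ => hP x a) ?_
  calc ∑ a : A, (traceOutAB σ.1 * registerBlock a x (quadratureQ α w Z)).trace.re
      ≤ ∑ a ∈ P.outA x, (traceOutAB σ.1 * registerBlock a x (quadratureQ α w Z)).trace.re :=
        Finset.sum_le_sum_of_subset_of_nonpos' (Finset.subset_univ _) fun a _ _ => hQ_nonpos x a
    _ = ∑ a : P.outA x, (traceOutAB σ.1 * registerBlock a.1 x (quadratureQ α w Z)).trace.re :=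
        (Finset.sum_coe_sort _ _).symm
    _ ≤ _ := Finset.sum_le_sum fun a _ => hQ x a.1

variable [DecidableEq Y] [Fintype C] [DecidableEq C]

theorem exists_keyEntropy_bound (hα : α ∈ Set.Ioo (1 : ℝ) 2) (hm : 1 ≤ m)
    (h : IsGaussRadauJacobi α t w) (𝒟 : P.Device dA dB) (σ : NormalizedState dA dB dE) :
    ∃ r : ℝ, 0 < r ∧
      keyEntropy α (P.roundOutput 𝒟 σ) = ((-(1 / (α - 1) * Real.logb 2 r) : ℝ) : EReal) ∧
      ∃ Z : (x : X) → P.outA x → Fin m → Matrix (Fin dE) (Fin dE) ℂ,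
        r ≤ ∑ x, P.keyProb x * ∑ a : P.outA x,
          quadratureTrace α t w (aliceState 𝒟 σ x a) (traceOutAB σ.1) (Z x a) := by
  have hker := keyState_mulVec_eq_zero 𝒟 σ
  have htr := trace_keyState 𝒟 σ
  have hpos := posSemidef_keyState 𝒟 σ
  have hpos' := posSemidef_one_kronecker_reduceRight_keyState 𝒟 σ
  refine ⟨(matPow (keyState 𝒟 σ) α *
    matPow ((1 : Matrix A A ℂ) ⊗ₖ reduceRight (keyState 𝒟 σ)) (1 - α)).trace.re, ?_, ?_, ?_⟩
  · exact re_trace_matPow_mul_matPow_pos hpos hpos' hker (by rw [htr]; exact zero_lt_one) _ _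
  · rw [keyEntropy, petzCondEntropy, reduceAXE_conditionKey_roundOutput, petzDivergence,
      if_pos (Or.inr hker), htr, Complex.one_re, div_one, EReal.coe_neg]
  · obtain ⟨Z, hZ⟩ := IsGaussRadauJacobi.exists_trace_le hα h hm hpos hpos' hker
    exact ⟨_, hZ.trans (quadratureTrace_keyState_le hα (h.node_mem_Ioc hα)
      (fun i => (h.weight_pos hα i).le) 𝒟 σ Z)⟩

end Protocol

end KeyEntropy

/-! ### Naimark dilation -/

section Naimark

universe u v w

open Matrix

/-- A projective measurement with outcomes in `O`: orthogonal projections that sum to `1`. -/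
structure IsProjectiveMeasurement {O k : Type*} [Fintype O] [Fintype k] [DecidableEq k]
    (E : O → Matrix k k ℂ) : Prop where
  isStarProjection : ∀ a, IsStarProjection (E a)
  sum_eq_one : ∑ a, E a = 1

namespace IsProjectiveMeasurement

variable {O k : Type*} [Fintype O] [Fintype k] [DecidableEq k] {E : O → Matrix k k ℂ}

lemma conjTranspose_eq (hE : IsProjectiveMeasurement E) (a : O) : (E a)ᴴ = E a :=
  (hE.isStarProjection a).isSelfAdjoint

lemma mul_self (hE : IsProjectiveMeasurement E) (a : O) : E a * E a = E a :=
  (hE.isStarProjection a).isIdempotentElem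

lemma posSemidef (hE : IsProjectiveMeasurement E) (a : O) : (E a).PosSemidef := by
  simpa only [hE.conjTranspose_eq, hE.mul_self] using posSemidef_conjTranspose_mul_self (E a)

lemma conj (hE : IsProjectiveMeasurement E) {U : Matrix k k ℂ} (hU : U ∈ unitary (Matrix k k ℂ)) :
    IsProjectiveMeasurement fun a => star U * E a * U where
  isStarProjection a := by
    simpa only [Unitary.conjStarAlgAut_star_apply] using
      (hE.isStarProjection a).map (Unitary.conjStarAlgAut ℂ (Matrix k k ℂ) (star ⟨U, hU⟩))
  sum_eq_one := by
    rw [← Finset.sum_mul, ← Finset.mul_sum, hE.sum_eq_one, mul_one, Unitary.star_mul_self_of_mem hU]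

end IsProjectiveMeasurement

/-- The measurement which reads off the label `f i` of a basis vector `i`. -/
def labelProjection {O k : Type*} [DecidableEq O] [DecidableEq k] (f : k → O) (a : O) :
    Matrix k k ℂ :=
  diagonal fun i => if f i = a then 1 else 0

lemma isProjectiveMeasurement_labelProjection {O k : Type*} [Fintype O] [DecidableEq O] [Fintype k]
    [DecidableEq k] (f : k → O) : IsProjectiveMeasurement (labelProjection f) where
  isStarProjection a :=
    ⟨by simp [IsIdempotentElem, labelProjection], by
      simp [IsSelfAdjoint, labelProjection, star_eq_conjTranspose, diagonal_conjTranspose,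
        Pi.star_def, apply_ite]⟩
  sum_eq_one := by
    ext i j
    by_cases hij : i = j <;> simp [hij, labelProjection, Matrix.sum_apply, Matrix.one_apply]

/-- The self-adjoint unitary on `n ⊕ k` whose corner is the isometry `W`. -/
def isometryDilation {n k : Type*} [Fintype n] [DecidableEq k] (W : Matrix k n ℂ) :
    Matrix (n ⊕ k) (n ⊕ k) ℂ :=
  fromBlocks 0 Wᴴ W (1 - W * Wᴴ)

section Isometry

variable {n k : Type*} [Fintype n] [DecidableEq k]

lemma star_isometryDilation (W : Matrix k n ℂ) :
    star (isometryDilation W) = isometryDilation W := by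
  simp [isometryDilation, star_eq_conjTranspose, fromBlocks_conjTranspose]

variable [DecidableEq n] [Fintype k]

lemma isometryDilation_mem_unitary {W : Matrix k n ℂ} (hW : Wᴴ * W = 1) :
    isometryDilation W ∈ unitary (Matrix (n ⊕ k) (n ⊕ k) ℂ) := by
  have hrange : W * Wᴴ * (W * Wᴴ) = W * Wᴴ := by
    rw [Matrix.mul_assoc, ← Matrix.mul_assoc Wᴴ, hW, Matrix.one_mul]
  have hmul : isometryDilation W * isometryDilation W = 1 := by
    rw [isometryDilation, fromBlocks_multiply, ← fromBlocks_one]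
    congr 1
    · rw [Matrix.zero_mul, zero_add, hW]
    · rw [Matrix.zero_mul, zero_add, Matrix.mul_sub, Matrix.mul_one, ← Matrix.mul_assoc, hW,
        Matrix.one_mul, sub_self]
    · rw [Matrix.mul_zero, zero_add, Matrix.sub_mul, Matrix.one_mul, Matrix.mul_assoc, hW,
        Matrix.mul_one, sub_self]
    · rw [sub_mul, one_mul, mul_sub, mul_one, hrange, sub_self, sub_zero, add_sub_cancel]
  exact Unitary.mem_iff.2 ⟨by rw [star_isometryDilation, hmul], by rw [star_isometryDilation, hmul]⟩

end Isometry

section Compression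

variable {O k n : Type*} [Nonempty O] [Fintype k] [DecidableEq k] [Fintype n] [DecidableEq n]

lemma exists_compression_labelProjection [DecidableEq O] {g : O → k} (hg : Function.Injective g)
    {M : O → Matrix n n ℂ} (hM : ∀ a, (M a).PosSemidef) :
    ∃ (f : n × k → O) (W : Matrix (n × k) n ℂ), ∀ a, Wᴴ * labelProjection f a * W = M a := by
  classical
  choose F hF using fun a => exists_eq_conjTranspose_mul_self (hM a)
  refine ⟨fun r => Function.invFun g r.2,
    of fun r j => if r.2 ∈ Set.range g then F (Function.invFun g r.2) r.1 j else 0, fun a => ?_⟩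
  ext i j
  rw [Matrix.mul_apply, hF, Matrix.mul_apply, Fintype.sum_prod_type]
  refine Finset.sum_congr rfl fun l _ => ?_
  have hinv (b : O) : Function.invFun g (g b) = b := Function.leftInverse_invFun hg b
  rw [Fintype.sum_eq_single (g a)]
  · simp [labelProjection, Matrix.mul_diagonal, hinv]
  · intro s hs
    by_cases hmem : s ∈ Set.range g
    · obtain ⟨b, rfl⟩ := hmem
      have hba : b ≠ a := ne_of_apply_ne g hs
      simp [labelProjection, Matrix.mul_diagonal, hinv, hba]
    · rw [of_apply, if_neg hmem, mul_zero]

lemma exists_isProjectiveMeasurement_toBlocks₁₁ [Fintype O] {g : O → k}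
    (hg : Function.Injective g) {M : O → Matrix n n ℂ} (hM : ∀ a, (M a).PosSemidef)
    (hsum : ∑ a, M a = 1) :
    ∃ E : O → Matrix (n ⊕ n × k) (n ⊕ n × k) ℂ,
      IsProjectiveMeasurement E ∧ ∀ a, (E a).toBlocks₁₁ = M a := by
  classical
  obtain ⟨f, W, hW⟩ := exists_compression_labelProjection hg hM
  have hisometry : Wᴴ * W = 1 := by
    rw [← hsum, ← Finset.sum_congr rfl fun a _ => hW a, ← Matrix.sum_mul, ← Matrix.mul_sum,
      (isProjectiveMeasurement_labelProjection f).sum_eq_one, Matrix.mul_one]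
  let label : n ⊕ n × k → O := Sum.elim (fun _ => Classical.arbitrary O) f
  refine ⟨_, (isProjectiveMeasurement_labelProjection label).conj
    (isometryDilation_mem_unitary hisometry), fun a => ?_⟩
  have hlabel : labelProjection label a =
      fromBlocks (labelProjection (fun _ => Classical.arbitrary O) a) 0 0
        (labelProjection f a) := by
    simp only [labelProjection, fromBlocks_diagonal]
    congr 1
    ext (i | i) <;> rfl
  rw [star_isometryDilation, hlabel, isometryDilation, fromBlocks_multiply, fromBlocks_multiply,
    toBlocks_fromBlocks₁₁, ← hW a]
  simp only [Matrix.zero_mul, Matrix.mul_zero, zero_add]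

end Compression

theorem exists_projective_dilation {X : Type u} [Finite X] {O : X → Type v}
    [∀ x, Fintype (O x)] [∀ x, Nonempty (O x)] {n : Type w} [Finite n] [DecidableEq n]
    {M : ∀ x, O x → Matrix n n ℂ} (hM : ∀ x a, (M x a).PosSemidef) (hsum : ∀ x, ∑ a, M x a = 1) :
    ∃ (k : Type (max u v w)) (_ : Fintype k) (_ : DecidableEq k) (V : Matrix k n ℂ)
      (E : ∀ x, O x → Matrix k k ℂ), Vᴴ * V = 1 ∧ (∀ x, IsProjectiveMeasurement (E x)) ∧
      ∀ x a, Vᴴ * E x a * V = M x a := by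
  classical
  cases nonempty_fintype X
  cases nonempty_fintype n
  choose E hE hcorner using fun x =>
    exists_isProjectiveMeasurement_toBlocks₁₁ (sigma_mk_injective (β := O)) (hM x) (hsum x)
  let V : Matrix (n ⊕ n × Σ x, O x) n ℂ := fromRows 1 0
  have hcompress (K : Matrix (n ⊕ n × Σ x, O x) (n ⊕ n × Σ x, O x) ℂ) :
      Vᴴ * K * V = K.toBlocks₁₁ := by
    rw [conjTranspose_fromRows_eq_fromCols_conjTranspose, ← fromBlocks_toBlocks K,
      fromCols_mul_fromBlocks, fromCols_mul_fromRows]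
    simp
  refine ⟨n ⊕ n × Σ x, O x, inferInstance, inferInstance, V, E, ?_, hE,
    fun x a => (hcompress _).trans (hcorner x a)⟩
  rw [conjTranspose_fromRows_eq_fromCols_conjTranspose, fromCols_mul_fromRows]
  simp

end Naimark

/-! ### Feasible points of the relaxation -/

section MomentMatrix

open Matrix

lemma posSemidef_blockDiagonal' {𝕜 o : Type*} [RCLike 𝕜] [DecidableEq o] {k : o → Type*}
    {K : ∀ i, Matrix (k i) (k i) 𝕜} (hK : ∀ i, (K i).PosSemidef) :
    (blockDiagonal' K).PosSemidef := by
  refine ⟨?_, fun x => ?_⟩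
  · rw [IsHermitian, blockDiagonal'_conjTranspose]
    exact congrArg _ (funext fun i => (hK i).1)
  · rw [Finsupp.sigma_sum]
    refine Finset.sum_nonneg fun i hi => ?_
    refine ((hK i).2 (x.split i)).trans_eq (Finsupp.sum_congr fun a _ => ?_)
    rw [Finsupp.sigma_sum, Finset.sum_eq_single_of_mem i hi]
    · simp only [blockDiagonal'_apply_eq]
    · intro j _ hj
      simp [blockDiagonal'_apply_ne K _ _ hj.symm]

lemma posSemidef_re_trace_gram {n ι : Type*} [Fintype n] [Finite ι] {K S : Matrix n n ℂ}
    (hK : K.PosSemidef) (hS : S.PosSemidef) (R : ι → Matrix n n ℂ) :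
    (of fun u v => ((R u)ᴴ * K * R v * S).trace.re : Matrix ι ι ℝ).PosSemidef := by
  cases nonempty_fintype ι
  refine PosSemidef.of_dotProduct_mulVec_nonneg ?_ fun c => ?_
  · ext u v
    have hadj : ((R v)ᴴ * K * R u * S).trace = star ((R u)ᴴ * K * R v * S).trace := by
      rw [← trace_conjTranspose, conjTranspose_mul, conjTranspose_mul, conjTranspose_mul,
        conjTranspose_conjTranspose, hS.1.eq, hK.1.eq, trace_mul_comm, mul_assoc]
    rw [conjTranspose_apply, of_apply, of_apply, star_trivial, hadj, Complex.star_def,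
      Complex.conj_re]
  · let T := ∑ u, (c u : ℂ) • R u
    have hform : (Tᴴ * K * T * S).trace.re =
        star c ⬝ᵥ (of fun u v => ((R u)ᴴ * K * R v * S).trace.re) *ᵥ c := by
      simp only [T, conjTranspose_sum, conjTranspose_smul, Finset.sum_mul, Finset.mul_sum,
        trace_sum, smul_mul_assoc, mul_smul_comm, trace_smul, Complex.re_sum, dotProduct, mulVec,
        of_apply, smul_eq_mul, Complex.star_def, Complex.conj_ofReal, Complex.re_ofReal_mul,
        Pi.star_apply, star_trivial]
      rw [Finset.sum_comm]
      exact Finset.sum_congr rfl fun u _ => Finset.sum_congr rfl fun v _ => by ring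
    exact hform ▸ re_trace_mul_nonneg (hK.conjTranspose_mul_mul_same T) hS

variable {X Y A B C : Type*} [Fintype X] [Fintype Y] {P : Protocol X Y A B C} {m : ℕ}
  {n : Type*} [Fintype n] [DecidableEq n]

/-- The evaluation of noncommutative polynomials at given matrices. -/
noncomputable def ncEval (r : Letter P m → Matrix n n ℂ) : NCPoly P m →ₐ[ℝ] Matrix n n ℂ :=
  MonoidAlgebra.lift ℝ (Matrix n n ℂ) (NCWord P m) (FreeMonoid.lift r)

lemma ncEval_mono (r : Letter P m → Matrix n n ℂ) (u : NCWord P m) :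
    ncEval r (mono u) = FreeMonoid.lift r u :=
  MonoidAlgebra.lift_of _ _

lemma ncEval_ncVar (r : Letter P m → Matrix n n ℂ) (l : Letter P m) :
    ncEval r (ncVar l) = r l := by
  rw [ncVar, ncEval_mono, FreeMonoid.lift_eval_of]

lemma ncEval_mono_adj {r : Letter P m → Matrix n n ℂ} (hr : ∀ l, r l.adj = (r l)ᴴ)
    (u : NCWord P m) : ncEval r (mono u.adj) = (ncEval r (mono u))ᴴ := by
  rw [ncEval_mono, ncEval_mono]
  induction u using FreeMonoid.inductionOn' with
  | one => simp [NCWord.adj]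
  | of_mul l u ih =>
    have hadj : NCWord.adj (FreeMonoid.of l * u) = NCWord.adj u * FreeMonoid.of l.adj := by
      simp [NCWord.adj]
    rw [hadj, map_mul, map_mul, ih, FreeMonoid.lift_eval_of, FreeMonoid.lift_eval_of,
      conjTranspose_mul, hr]

namespace NPARelaxation

variable {α : ℝ} {t w : Fin m → ℝ} (R : NPARelaxation P α t w)

/-- The values of the variables of the relaxation at given matrices and a given state. -/
noncomputable def moments (r : Letter P m → Matrix n n ℂ) (S : Matrix n n ℂ) : R.words → ℝ :=
  fun u => (ncEval r (mono u.1) * S).trace.re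

lemma lin_moments (r : Letter P m → Matrix n n ℂ) (S : Matrix n n ℂ) {p : NCPoly P m}
    (hp : p.coeff.support ⊆ R.words) :
    R.lin p (R.moments r S) = (ncEval r p * S).trace.re := by
  have hexpand : ncEval r p = ∑ u ∈ R.words, p.coeff u • ncEval r (mono u) := by
    rw [ncEval, MonoidAlgebra.lift_apply, Finsupp.sum_of_support_subset _ hp _ (by simp)]
    exact Finset.sum_congr rfl fun u _ => by rw [← ncEval_mono]; rfl
  simp only [hexpand, Finset.sum_mul, trace_sum, Complex.re_sum, smul_mul_assoc, trace_smul,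
    Complex.smul_re, smul_eq_mul, lin, moments]
  exact Finset.sum_coe_sort R.words fun u => p.coeff u * (ncEval r (mono u) * S).trace.re

lemma posSemidef_momentMatrix {r : Letter P m → Matrix n n ℂ} (hr : ∀ l, r l.adj = (r l)ᴴ)
    (hA : ∀ x a, (r (.alice x a)).PosSemidef) (hB : ∀ y b, (r (.bob y b)).PosSemidef)
    (hrel : ∀ k : NPARelation P m, ncEval r k.poly = 0) {S : Matrix n n ℂ} (hS : S.PosSemidef) :
    (R.momentMatrix (R.moments r S)).PosSemidef := by
  classical
  refine posSemidef_blockDiagonal' fun j => ?_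
  have hconstraint : (ncEval r j.poly).PosSemidef := by
    cases j with
    | unit => simpa [NPAConstraint.poly] using PosSemidef.one
    | posA x a => simpa only [NPAConstraint.poly, ncEval_ncVar] using hA x a
    | posB y b => simpa only [NPAConstraint.poly, ncEval_ncVar] using hB y b
    | eqNonneg k => simpa only [NPAConstraint.poly, hrel] using PosSemidef.zero
    | eqNonpos k => simpa only [NPAConstraint.poly, map_neg, hrel, neg_zero] using PosSemidef.zero
  convert! posSemidef_re_trace_gram hconstraint hS fun u : R.index j => ncEval r (mono u.1) using 1
  ext u v
  rw [of_apply, of_apply, R.lin_moments r S (R.entry_mem j u.1 u.2 v.1 v.2), map_mul, map_mul,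
    ncEval_mono_adj hr]

end NPARelaxation

end MomentMatrix

section Realization

open Matrix

variable {kA kB nE : Type*} [Fintype kA] [DecidableEq kA] [Fintype kB] [DecidableEq kB]
  [Fintype nE] [DecidableEq nE]

/-- Operators of the environment as operators of the whole system. -/
def eveEmbedding (kA kB nE : Type*) [Fintype kA] [DecidableEq kA] [Fintype kB] [DecidableEq kB]
    [Fintype nE] [DecidableEq nE] :
    Matrix nE nE ℂ →ₐ[ℝ] Matrix (kA × kB × nE) (kA × kB × nE) ℂ where
  toFun K := (1 : Matrix kA kA ℂ) ⊗ₖ ((1 : Matrix kB kB ℂ) ⊗ₖ K)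
  map_one' := by rw [one_kronecker_one, one_kronecker_one]
  map_mul' K L := by
    rw [← mul_kronecker_mul, ← mul_kronecker_mul, Matrix.one_mul, Matrix.one_mul]
  map_zero' := by rw [kronecker_zero, kronecker_zero]
  map_add' K L := by rw [kronecker_add, kronecker_add]
  commutes' r := by
    rw [Algebra.algebraMap_eq_smul_one, Algebra.algebraMap_eq_smul_one, kronecker_smul,
      kronecker_smul, one_kronecker_one, one_kronecker_one]

lemma eveEmbedding_apply (K : Matrix nE nE ℂ) :
    eveEmbedding kA kB nE K = (1 : Matrix kA kA ℂ) ⊗ₖ ((1 : Matrix kB kB ℂ) ⊗ₖ K) := rfl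

variable {X Y A B C : Type*} [Fintype X] [Fintype Y] {P : Protocol X Y A B C} {m : ℕ}

/-- The matrices that represent the variables of the relaxation. -/
noncomputable def letterMatrix (EA : ∀ x, P.outA x → Matrix kA kA ℂ)
    (EB : ∀ y, P.outB y → Matrix kB kB ℂ) (Z : ∀ x, P.outA x → Fin m → Matrix nE nE ℂ) :
    Letter P m → Matrix (kA × kB × nE) (kA × kB × nE) ℂ
  | .alice x a => EA x a ⊗ₖ ((1 : Matrix kB kB ℂ) ⊗ₖ (1 : Matrix nE nE ℂ))
  | .bob y b => (1 : Matrix kA kA ℂ) ⊗ₖ (EB y b ⊗ₖ (1 : Matrix nE nE ℂ))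
  | .eve x a i => eveEmbedding kA kB nE (Z x.1 a i)
  | .eveAdj x a i => eveEmbedding kA kB nE (Z x.1 a i)ᴴ

variable {EA : ∀ x, P.outA x → Matrix kA kA ℂ} {EB : ∀ y, P.outB y → Matrix kB kB ℂ}
  {Z : ∀ x, P.outA x → Fin m → Matrix nE nE ℂ}

lemma letterMatrix_adj (hEA : ∀ x a, (EA x a)ᴴ = EA x a) (hEB : ∀ y b, (EB y b)ᴴ = EB y b)
    (l : Letter P m) : letterMatrix EA EB Z l.adj = (letterMatrix EA EB Z l)ᴴ := by
  cases l <;> simp [Letter.adj, letterMatrix, eveEmbedding_apply, conjTranspose_kronecker, hEA, hEB]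

lemma ncEval_letterMatrix_relation (hEA : ∀ x, IsProjectiveMeasurement (EA x))
    (hEB : ∀ y, IsProjectiveMeasurement (EB y)) (k : NPARelation P m) :
    ncEval (letterMatrix EA EB Z) k.poly = 0 := by
  cases k <;>
    simp only [NPARelation.poly, ncComm, map_sub, map_sum, map_mul, map_one, ncEval_ncVar,
      letterMatrix, eveEmbedding_apply, ← finsetSum_kronecker, ← kronecker_finsetSum,
      (hEA _).sum_eq_one, (hEB _).sum_eq_one, one_kronecker_one, sub_self, ← mul_kronecker_mul,
      Matrix.one_mul, Matrix.mul_one, (hEA _).mul_self, (hEB _).mul_self]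

lemma posSemidef_momentMatrix_letterMatrix {α : ℝ} {t w : Fin m → ℝ} (R : NPARelaxation P α t w)
    (hEA : ∀ x, IsProjectiveMeasurement (EA x)) (hEB : ∀ y, IsProjectiveMeasurement (EB y))
    {S : Matrix (kA × kB × nE) (kA × kB × nE) ℂ} (hS : S.PosSemidef) :
    (R.momentMatrix (R.moments (letterMatrix EA EB Z) S)).PosSemidef :=
  R.posSemidef_momentMatrix
    (letterMatrix_adj (fun x => (hEA x).conjTranspose_eq) fun y => (hEB y).conjTranspose_eq)
    (fun x a => ((hEA x).posSemidef a).kronecker (PosSemidef.one.kronecker PosSemidef.one))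
    (fun y b => PosSemidef.one.kronecker (((hEB y).posSemidef b).kronecker PosSemidef.one))
    (ncEval_letterMatrix_relation hEA hEB) hS

lemma ncEval_evePolyP (α : ℝ) (t w : Fin m → ℝ) (x : P.keyX) (a : P.outA x.1) :
    ncEval (letterMatrix EA EB Z) (evePolyP α t w x a) =
      eveEmbedding kA kB nE (quadratureP α t w (Z x.1 a)) := by
  simp only [evePolyP, quadratureP, map_add, map_smul, map_sum, map_mul, map_one, ncEval_ncVar,
    letterMatrix]

lemma ncEval_evePolyQ (α : ℝ) (w : Fin m → ℝ) (x : P.keyX) (a : P.outA x.1) :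
    ncEval (letterMatrix EA EB Z) (evePolyQ α w x a) =
      eveEmbedding kA kB nE (quadratureQ α w (Z x.1 a)) := by
  simp only [evePolyQ, quadratureQ, map_smul, map_sum, map_mul, ncEval_ncVar, letterMatrix]

lemma re_trace_ncEval_testPoly_mul [DecidableEq C] (S : Matrix (kA × kB × nE) (kA × kB × nE) ℂ)
    (c : Option C) :
    (ncEval (letterMatrix EA EB Z) (testPoly P m c) * S).trace.re =
      ∑ x, ∑ y, ∑ s, ∑ a : P.outA x, ∑ b : P.outB y,
        P.inputProb x y s * if P.testData a.1 b.1 x y s = c then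
          ((EA x a ⊗ₖ (EB y b ⊗ₖ (1 : Matrix nE nE ℂ))) * S).trace.re else 0 := by
  have hproduct (x : X) (y : Y) (a : P.outA x) (b : P.outB y) :
      letterMatrix EA EB Z (.alice x a) * letterMatrix EA EB Z (.bob y b) =
        EA x a ⊗ₖ (EB y b ⊗ₖ (1 : Matrix nE nE ℂ)) := by
    simp only [letterMatrix, ← mul_kronecker_mul, Matrix.one_mul, Matrix.mul_one]
  simp only [testPoly, map_sum, Finset.sum_mul, trace_sum, Complex.re_sum, mul_ite, mul_zero]
  refine Finset.sum_congr rfl fun x _ => Finset.sum_congr rfl fun y _ =>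
    Finset.sum_congr rfl fun s _ => Finset.sum_congr rfl fun a _ =>
      Finset.sum_congr rfl fun b _ => ?_
  by_cases hc : P.testData a.1 b.1 x y s = c
  · simp only [if_pos hc, map_smul, map_mul, ncEval_ncVar, hproduct, smul_mul_assoc, trace_smul,
      Complex.smul_re, smul_eq_mul]
  · simp only [if_neg hc, map_zero, Matrix.zero_mul, trace_zero, Complex.zero_re]

lemma re_trace_ncEval_entropyPoly_mul (α : ℝ) (t w : Fin m → ℝ)
    (S : Matrix (kA × kB × nE) (kA × kB × nE) ℂ) :
    (ncEval (letterMatrix EA EB Z) (entropyPoly P α t w) * S).trace.re =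
      ∑ x, P.keyProb x * ∑ a : P.outA x,
        (((EA x a ⊗ₖ ((1 : Matrix kB kB ℂ) ⊗ₖ quadratureP α t w (Z x a))) * S).trace.re +
          (eveEmbedding kA kB nE (quadratureQ α w (Z x a)) * S).trace.re) := by
  have hproduct (x : P.keyX) (a : P.outA x.1) :
      letterMatrix EA EB Z (.alice x.1 a) *
          eveEmbedding kA kB nE (quadratureP α t w (Z x.1 a)) =
        EA x.1 a ⊗ₖ ((1 : Matrix kB kB ℂ) ⊗ₖ quadratureP α t w (Z x.1 a)) := by
    simp only [letterMatrix, eveEmbedding_apply, ← mul_kronecker_mul, Matrix.one_mul,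
      Matrix.mul_one]
  simp only [entropyPoly, map_sum, map_smul, map_add, map_mul, ncEval_ncVar, ncEval_evePolyP,
    ncEval_evePolyQ, hproduct, Finset.sum_mul, smul_mul_assoc, trace_sum, trace_smul,
    Complex.re_sum, Complex.smul_re, smul_eq_mul, Matrix.add_mul, trace_add, Complex.add_re]
  refine (Finset.sum_coe_sort P.keyX fun x => P.keyProb x * ∑ a : P.outA x,
    (((EA x a ⊗ₖ ((1 : Matrix kB kB ℂ) ⊗ₖ quadratureP α t w (Z x a))) * S).trace.re +
      (eveEmbedding kA kB nE (quadratureQ α w (Z x a)) * S).trace.re)).trans ?_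
  refine Finset.sum_subset (Finset.subset_univ _) fun x _ hx => ?_
  rw [P.keyProb_eq_zero hx, zero_mul]

end Realization

section Dilation

open Matrix

variable {kA kB nA nB nE : Type*} [Fintype kA] [Fintype kB] [Fintype nA] [Fintype nB] [Fintype nE]
  [DecidableEq nE]

/-- The state `σ` transported by local maps `VA` and `VB` of the first two systems. -/
noncomputable def transportState (VA : Matrix kA nA ℂ) (VB : Matrix kB nB ℂ)
    (σ : Matrix (nA × nB × nE) (nA × nB × nE) ℂ) :
    Matrix (kA × kB × nE) (kA × kB × nE) ℂ :=
  (VA ⊗ₖ (VB ⊗ₖ (1 : Matrix nE nE ℂ))) * σ * (VA ⊗ₖ (VB ⊗ₖ (1 : Matrix nE nE ℂ)))ᴴ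

lemma trace_kronecker_mul_transportState (VA : Matrix kA nA ℂ) (VB : Matrix kB nB ℂ)
    (σ : Matrix (nA × nB × nE) (nA × nB × nE) ℂ) (K : Matrix kA kA ℂ) (L : Matrix kB kB ℂ)
    (N : Matrix nE nE ℂ) :
    ((K ⊗ₖ (L ⊗ₖ N)) * transportState VA VB σ).trace =
      (((VAᴴ * K * VA) ⊗ₖ ((VBᴴ * L * VB) ⊗ₖ N)) * σ).trace := by
  rw [transportState, ← Matrix.mul_assoc, trace_mul_comm, ← Matrix.mul_assoc, ← Matrix.mul_assoc,
    conjTranspose_kronecker, conjTranspose_kronecker, ← mul_kronecker_mul, ← mul_kronecker_mul,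
    ← mul_kronecker_mul, ← mul_kronecker_mul, conjTranspose_one, Matrix.one_mul, Matrix.mul_one]

lemma trace_eveEmbedding_mul_transportState [DecidableEq kA] [DecidableEq kB] [DecidableEq nA]
    [DecidableEq nB] {VA : Matrix kA nA ℂ} {VB : Matrix kB nB ℂ} (hVA : VAᴴ * VA = 1)
    (hVB : VBᴴ * VB = 1) (σ : Matrix (nA × nB × nE) (nA × nB × nE) ℂ) (N : Matrix nE nE ℂ) :
    (eveEmbedding kA kB nE N * transportState VA VB σ).trace =
      (((1 : Matrix nA nA ℂ) ⊗ₖ ((1 : Matrix nB nB ℂ) ⊗ₖ N)) * σ).trace := by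
  rw [eveEmbedding_apply, trace_kronecker_mul_transportState, Matrix.mul_one, hVA, Matrix.mul_one,
    hVB]

end Dilation

/-! ### The lower bound -/

section LowerBound

open Matrix

variable {X Y A B C : Type*} [Fintype X] [Fintype Y] {P : Protocol X Y A B C} {dA dB dE : ℕ}

lemma NormalizedState.nonempty_index (σ : NormalizedState dA dB dE) :
    Nonempty (Fin dA × Fin dB × Fin dE) := by
  by_contra hempty
  rw [not_nonempty_iff] at hempty
  exact zero_ne_one ((trace_eq_zero_of_isEmpty σ.1).symm.trans σ.2.2)

namespace Protocol

lemma Device.nonempty_outA [Nonempty (Fin dA)] (𝒟 : P.Device dA dB) (x : X) :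
    Nonempty (P.outA x) := by
  by_contra hempty
  rw [not_nonempty_iff] at hempty
  exact zero_ne_one ((Fintype.sum_empty _).symm.trans (𝒟.M_sum x))

lemma Device.nonempty_outB [Nonempty (Fin dB)] (𝒟 : P.Device dA dB) (y : Y) :
    Nonempty (P.outB y) := by
  by_contra hempty
  rw [not_nonempty_iff] at hempty
  exact zero_ne_one ((Fintype.sum_empty _).symm.trans (𝒟.N_sum y))

end Protocol

namespace NPARelaxation

variable {α : ℝ} {m : ℕ} {t w : Fin m → ℝ} (R : NPARelaxation P α t w)
  {kA kB : Type*} [Fintype kA] [DecidableEq kA] [Fintype kB] [DecidableEq kB]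
  {𝒟 : P.Device dA dB} {VA : Matrix kA (Fin dA) ℂ} {VB : Matrix kB (Fin dB) ℂ}
  {EA : ∀ x, P.outA x → Matrix kA kA ℂ} {EB : ∀ y, P.outB y → Matrix kB kB ℂ}
  (σ : NormalizedState dA dB dE)

lemma moments_one (hVA : VAᴴ * VA = 1) (hVB : VBᴴ * VB = 1)
    (Z : ∀ x, P.outA x → Fin m → Matrix (Fin dE) (Fin dE) ℂ) :
    R.moments (letterMatrix EA EB Z) (transportState VA VB σ.1) ⟨1, R.one_mem⟩ = 1 := by
  rw [moments, ncEval_mono, map_one, ← map_one (eveEmbedding kA kB (Fin dE)),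
    trace_eveEmbedding_mul_transportState hVA hVB, one_kronecker_one, one_kronecker_one,
    Matrix.one_mul, σ.2.2, Complex.one_re]

lemma f_moments [DecidableEq X] [DecidableEq Y] [Fintype A] [DecidableEq A] [DecidableEq C]
    (hEA : ∀ x a, VAᴴ * EA x a * VA = 𝒟.M x a) (hEB : ∀ y b, VBᴴ * EB y b * VB = 𝒟.N y b)
    (Z : ∀ x, P.outA x → Fin m → Matrix (Fin dE) (Fin dE) ℂ) :
    R.f (R.moments (letterMatrix EA EB Z) (transportState VA VB σ.1)) =
      testDataDist (P.roundOutput 𝒟 σ) := by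
  ext c
  simp only [f, R.lin_moments _ _ (R.test_mem c), re_trace_ncEval_testPoly_mul,
    trace_kronecker_mul_transportState, hEA, hEB, Protocol.testDataDist_roundOutput]

lemma g_moments (hVA : VAᴴ * VA = 1) (hVB : VBᴴ * VB = 1)
    (hEA : ∀ x a, VAᴴ * EA x a * VA = 𝒟.M x a)
    (Z : ∀ x, P.outA x → Fin m → Matrix (Fin dE) (Fin dE) ℂ) :
    R.g (R.moments (letterMatrix EA EB Z) (transportState VA VB σ.1)) =
      ∑ x, P.keyProb x * ∑ a : P.outA x,
        quadratureTrace α t w (P.aliceState 𝒟 σ x a) (traceOutAB σ.1) (Z x a) := by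
  simp only [g, R.lin_moments _ _ R.entropy_mem, re_trace_ncEval_entropyPoly_mul,
    trace_eveEmbedding_mul_transportState hVA hVB, trace_kronecker_mul_transportState, hEA,
    Matrix.mul_one, hVB, trace_one_kronecker_mul, quadratureTrace, Protocol.aliceState,
    trace_traceOutAB_mul]

end NPARelaxation

namespace Protocol

lemma exists_posSemidef_momentMatrix [DecidableEq X] [DecidableEq Y] [Fintype A] [DecidableEq A]
    [DecidableEq C] {α : ℝ} {m : ℕ} {t w : Fin m → ℝ} (R : NPARelaxation P α t w)
    (𝒟 : P.Device dA dB) (σ : NormalizedState dA dB dE)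
    (Z : ∀ x, P.outA x → Fin m → Matrix (Fin dE) (Fin dE) ℂ) :
    ∃ y : R.words → ℝ, y ⟨1, R.one_mem⟩ = 1 ∧ (R.momentMatrix y).PosSemidef ∧
      R.f y = testDataDist (P.roundOutput 𝒟 σ) ∧
      R.g y = ∑ x, P.keyProb x * ∑ a : P.outA x,
        quadratureTrace α t w (P.aliceState 𝒟 σ x a) (traceOutAB σ.1) (Z x a) := by
  obtain ⟨i, j, -⟩ := σ.nonempty_index
  have : Nonempty (Fin dA) := ⟨i⟩
  have : Nonempty (Fin dB) := ⟨j⟩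
  have := 𝒟.nonempty_outA
  have := 𝒟.nonempty_outB
  obtain ⟨kA, _, _, VA, EA, hVA, hEA, hEAM⟩ := exists_projective_dilation 𝒟.M_pos 𝒟.M_sum
  obtain ⟨kB, _, _, VB, EB, hVB, hEB, hEBN⟩ := exists_projective_dilation 𝒟.N_pos 𝒟.N_sum
  exact ⟨R.moments (letterMatrix EA EB Z) (transportState VA VB σ.1), R.moments_one σ hVA hVB Z,
    posSemidef_momentMatrix_letterMatrix R hEA hEB (σ.2.1.mul_mul_conjTranspose_same _),
    R.f_moments σ hEAM hEBN Z, R.g_moments σ hVA hVB hEAM Z⟩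

theorem value_le_roundValue [DecidableEq X] [DecidableEq Y] [Fintype A] [DecidableEq A]
    [Fintype C] [DecidableEq C] {α : ℝ} (hα : α ∈ Set.Ioo (1 : ℝ) 2) {m : ℕ} (hm : 1 ≤ m)
    {t w : Fin m → ℝ} (h : IsGaussRadauJacobi α t w) (R : NPARelaxation P α t w)
    {SΩ : Set (Option C → ℝ)} (hq : 0 ≤ qMin SΩ) :
    R.value SΩ ≤ P.roundValue α SΩ := by
  refine le_iInf fun dA => le_iInf fun dB => le_iInf fun dE => le_iInf fun 𝒟 => le_iInf fun q =>
    le_iInf fun hqΩ => le_iInf fun σ => ?_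
  obtain ⟨r, hr, hentropy, Z, hZ⟩ := exists_keyEntropy_bound hα hm h 𝒟 σ
  obtain ⟨y, hone, hpos, hf, hg⟩ := exists_posSemidef_momentMatrix R 𝒟 σ Z
  have hrg : r ≤ R.g y := hZ.trans_eq hg.symm
  have hlog : Real.logb 2 r ≤ Real.logb 2 (R.g y) := Real.logb_le_logb_of_le one_lt_two hr hrg
  have hcoeff : qMin SΩ / (1 - α) ≤ 0 := div_nonpos_of_nonneg_of_nonpos hq (by linarith [hα.1])
  have hterm : qMin SΩ / (1 - α) * Real.logb 2 (R.g y) ≤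
      qMin SΩ * -(1 / (α - 1) * Real.logb 2 r) :=
    (mul_le_mul_of_nonpos_left hlog hcoeff).trans_eq (by rw [← neg_sub α 1, div_neg]; ring)
  refine (iInf₂_le (q, y) ⟨hqΩ, hone, hpos⟩).trans ?_
  rw [NPARelaxation.objective, roundObjective, hf, hentropy, elogTwo, if_pos (hr.trans_le hrg),
    ← EReal.coe_mul, ← EReal.coe_mul]
  exact add_le_add_right (EReal.coe_le_coe_iff.2 hterm) _

end Protocol

end LowerBound

/-! ### Convexity of the relaxation -/

section Convexity

lemma ereal_coe_mul_ne_bot {a : ℝ} (ha : 0 ≤ a) {x : EReal} (hx : x ≠ ⊥) : (a : EReal) * x ≠ ⊥ :=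
  (EReal.mul_ne_bot _ _).2 ⟨.inl (EReal.coe_ne_bot _), .inr hx, .inl (EReal.coe_ne_top _),
    .inl (EReal.coe_nonneg.2 ha)⟩

lemma ereal_coe_mul_add {a : ℝ} (ha : 0 ≤ a) (x y : EReal) :
    (a : EReal) * (x + y) = a * x + a * y :=
  EReal.left_distrib_of_nonneg_of_ne_top (EReal.coe_nonneg.2 ha) (EReal.coe_ne_top _) x y

lemma log_sum_inequality {q₁ q₂ p₁ p₂ : ℝ} (hq₁ : 0 ≤ q₁) (hq₂ : 0 ≤ q₂) (hp₁ : 0 < p₁)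
    (hp₂ : 0 < p₂) :
    (q₁ + q₂) * Real.log ((q₁ + q₂) / (p₁ + p₂)) ≤
      q₁ * Real.log (q₁ / p₁) + q₂ * Real.log (q₂ / p₂) := by
  have hp : 0 < p₁ + p₂ := add_pos hp₁ hp₂
  have hjensen := Real.convexOn_mul_log.2 (div_nonneg hq₁ hp₁.le) (div_nonneg hq₂ hp₂.le)
    (div_pos hp₁ hp).le (div_pos hp₂ hp).le (by rw [← add_div, div_self hp.ne'])
  have hmean : p₁ / (p₁ + p₂) * (q₁ / p₁) + p₂ / (p₁ + p₂) * (q₂ / p₂) =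
      (q₁ + q₂) / (p₁ + p₂) := by field_simp
  simp only [smul_eq_mul, hmean] at hjensen
  calc (q₁ + q₂) * Real.log ((q₁ + q₂) / (p₁ + p₂))
      = (p₁ + p₂) * ((q₁ + q₂) / (p₁ + p₂) * Real.log ((q₁ + q₂) / (p₁ + p₂))) := by field_simp
    _ ≤ (p₁ + p₂) * (p₁ / (p₁ + p₂) * (q₁ / p₁ * Real.log (q₁ / p₁)) +
          p₂ / (p₁ + p₂) * (q₂ / p₂ * Real.log (q₂ / p₂))) :=
        mul_le_mul_of_nonneg_left hjensen hp.le
    _ = q₁ * Real.log (q₁ / p₁) + q₂ * Real.log (q₂ / p₂) := by field_simp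

lemma relEntropyTerm_of_nonneg_of_pos {q p : ℝ} (hq : 0 ≤ q) (hp : 0 < p) :
    relEntropyTerm q p = ((q * Real.logb 2 (q / p) : ℝ) : EReal) := by
  rcases hq.eq_or_lt with rfl | hq
  · simp [relEntropyTerm, hp.le]
  · rw [relEntropyTerm, if_pos ⟨hq, hp⟩]

lemma relEntropyTerm_zero_zero : relEntropyTerm 0 0 = 0 := by
  simp [relEntropyTerm]

lemma relEntropyTerm_ne_bot (q p : ℝ) : relEntropyTerm q p ≠ ⊥ := by
  unfold relEntropyTerm
  split_ifs
  exacts [EReal.coe_ne_bot _, EReal.zero_ne_bot, top_ne_bot]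

lemma relEntropyTerm_eq_top_or (q p : ℝ) :
    relEntropyTerm q p = ⊤ ∨ (0 ≤ q ∧ 0 < p) ∨ (q = 0 ∧ p = 0) := by
  unfold relEntropyTerm
  split_ifs with hpos hzero
  · exact .inr (.inl ⟨hpos.1.le, hpos.2⟩)
  · exact .inr (hzero.2.lt_or_eq.imp (⟨hzero.1.ge, ·⟩) fun hp => ⟨hzero.1, hp.symm⟩)
  · exact .inl rfl

lemma relEntropyTerm_smul {a : ℝ} (ha : 0 < a) (q p : ℝ) :
    relEntropyTerm (a * q) (a * p) = (a : EReal) * relEntropyTerm q p := by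
  simp only [relEntropyTerm, mul_pos_iff_of_pos_left ha, mul_nonneg_iff_of_pos_left ha,
    mul_eq_zero, ha.ne', false_or]
  split_ifs
  · rw [mul_div_mul_left _ _ ha.ne', mul_assoc, EReal.coe_mul]
  · rw [mul_zero]
  · rw [EReal.coe_mul_top_of_pos ha]

lemma relEntropyTerm_add_le (q₁ q₂ p₁ p₂ : ℝ) :
    relEntropyTerm (q₁ + q₂) (p₁ + p₂) ≤ relEntropyTerm q₁ p₁ + relEntropyTerm q₂ p₂ := by
  rcases relEntropyTerm_eq_top_or q₁ p₁ with htop | ⟨hq₁, hp₁⟩ | ⟨rfl, rfl⟩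
  · rw [htop, EReal.top_add_of_ne_bot (relEntropyTerm_ne_bot _ _)]
    exact le_top
  · rcases relEntropyTerm_eq_top_or q₂ p₂ with htop | ⟨hq₂, hp₂⟩ | ⟨rfl, rfl⟩
    · rw [htop, EReal.add_top_of_ne_bot (relEntropyTerm_ne_bot _ _)]
      exact le_top
    · rw [relEntropyTerm_of_nonneg_of_pos (add_nonneg hq₁ hq₂) (add_pos hp₁ hp₂),
        relEntropyTerm_of_nonneg_of_pos hq₁ hp₁, relEntropyTerm_of_nonneg_of_pos hq₂ hp₂,
        ← EReal.coe_add, EReal.coe_le_coe_iff]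
      simp only [Real.logb, ← mul_div_assoc, ← add_div]
      exact div_le_div_of_nonneg_right (log_sum_inequality hq₁ hq₂ hp₁ hp₂)
        (Real.log_nonneg one_le_two)
    · rw [relEntropyTerm_zero_zero, add_zero, add_zero, add_zero]
  · rw [relEntropyTerm_zero_zero, zero_add, zero_add, zero_add]

lemma relEntropy_smul {ι : Type*} [Fintype ι] {a : ℝ} (ha : 0 < a) (q p : ι → ℝ) :
    relEntropy (a • q) (a • p) = (a : EReal) * relEntropy q p := by
  simp only [relEntropy, Pi.smul_apply, smul_eq_mul, relEntropyTerm_smul ha]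
  exact (map_sum (⟨⟨((a : EReal) * ·), mul_zero _⟩, ereal_coe_mul_add ha.le⟩ : EReal →+ EReal)
    _ _).symm

lemma relEntropy_add_le {ι : Type*} [Fintype ι] (q₁ q₂ p₁ p₂ : ι → ℝ) :
    relEntropy (q₁ + q₂) (p₁ + p₂) ≤ relEntropy q₁ p₁ + relEntropy q₂ p₂ := by
  unfold relEntropy
  rw [← Finset.sum_add_distrib]
  exact Finset.sum_le_sum fun c _ => relEntropyTerm_add_le _ _ _ _

lemma relEntropy_convex {ι : Type*} [Fintype ι] (q₁ q₂ p₁ p₂ : ι → ℝ) {a b : ℝ} (ha : 0 < a)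
    (hb : 0 < b) :
    relEntropy (a • q₁ + b • q₂) (a • p₁ + b • p₂) ≤
      (a : EReal) * relEntropy q₁ p₁ + (b : EReal) * relEntropy q₂ p₂ :=
  (relEntropy_add_le _ _ _ _).trans_eq (by rw [relEntropy_smul ha, relEntropy_smul hb])

lemma coe_mul_elogTwo_of_nonpos {k : ℝ} (hk : k < 0) {s : ℝ} (hs : s ≤ 0) :
    (k : EReal) * elogTwo s = ⊤ := by
  rw [elogTwo, if_neg hs.not_gt, EReal.coe_mul_bot_of_neg hk]

lemma coe_mul_elogTwo_ne_bot {k : ℝ} (hk : k < 0) (s : ℝ) : (k : EReal) * elogTwo s ≠ ⊥ := by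
  rcases le_or_gt s 0 with hs | hs
  · rw [coe_mul_elogTwo_of_nonpos hk hs]
    exact top_ne_bot
  · rw [elogTwo, if_pos hs, ← EReal.coe_mul]
    exact EReal.coe_ne_bot _

lemma concaveOn_logb {b : ℝ} (hb : 1 ≤ b) : ConcaveOn ℝ (Set.Ioi 0) (Real.logb b) := by
  simpa only [smul_eq_mul, ← div_eq_inv_mul, Real.log_div_log] using
    strictConcaveOn_log_Ioi.concaveOn.smul (inv_nonneg.2 (Real.log_nonneg hb))

lemma coe_mul_elogTwo_convex {k : ℝ} (hk : k ≤ 0) (s r : ℝ) {a b : ℝ} (ha : 0 < a) (hb : 0 < b)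
    (hab : a + b = 1) :
    (k : EReal) * elogTwo (a * s + b * r) ≤
      (a : EReal) * ((k : EReal) * elogTwo s) + (b : EReal) * ((k : EReal) * elogTwo r) := by
  rcases hk.eq_or_lt with rfl | hk
  · simp
  rcases le_or_gt s 0 with hs | hs
  · rw [coe_mul_elogTwo_of_nonpos hk hs, EReal.coe_mul_top_of_pos ha, EReal.top_add_of_ne_bot
      (ereal_coe_mul_ne_bot hb.le (coe_mul_elogTwo_ne_bot hk r))]
    exact le_top
  rcases le_or_gt r 0 with hr | hr
  · rw [coe_mul_elogTwo_of_nonpos hk hr, EReal.coe_mul_top_of_pos hb, EReal.add_top_of_ne_bot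
      (ereal_coe_mul_ne_bot ha.le (coe_mul_elogTwo_ne_bot hk s))]
    exact le_top
  have hconcave := (concaveOn_logb one_le_two).2 hs hr ha.le hb.le hab
  simp only [smul_eq_mul] at hconcave
  rw [elogTwo, elogTwo, elogTwo, if_pos hs, if_pos hr, if_pos (by positivity)]
  simp only [← EReal.coe_mul, ← EReal.coe_add]
  rw [EReal.coe_le_coe_iff]
  exact (mul_le_mul_of_nonpos_left hconcave hk.le).trans_eq (by ring)

lemma qMin_nonneg {C : Type*} [Fintype C] {SΩ : Set (Option C → ℝ)}
    (hSΩ : SΩ ⊆ stdSimplex ℝ (Option C)) : 0 ≤ qMin SΩ := by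
  refine Real.sInf_nonneg ?_
  rintro _ ⟨q, hq, rfl⟩
  exact (hSΩ hq).1 none

namespace NPARelaxation

variable {X Y A B C : Type*} [Fintype X] [Fintype Y] {P : Protocol X Y A B C} {m : ℕ}
  {α : ℝ} {t w : Fin m → ℝ} (R : NPARelaxation P α t w)

lemma lin_add_smul (p : NCPoly P m) (a b : ℝ) (y z : R.words → ℝ) :
    R.lin p (a • y + b • z) = a * R.lin p y + b * R.lin p z := by
  simp only [lin, Finset.mul_sum, ← Finset.sum_add_distrib, Pi.add_apply, Pi.smul_apply,
    smul_eq_mul]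
  exact Finset.sum_congr rfl fun u _ => by ring

lemma momentMatrix_add_smul (a b : ℝ) (y z : R.words → ℝ) :
    R.momentMatrix (a • y + b • z) = a • R.momentMatrix y + b • R.momentMatrix z := by
  simp only [momentMatrix, ← Matrix.blockDiagonal'_smul, ← Matrix.blockDiagonal'_add]
  congr 1
  ext j u v
  exact R.lin_add_smul _ a b y z

lemma convex_feasible {SΩ : Set (Option C → ℝ)} (hconv : Convex ℝ SΩ) :
    Convex ℝ (R.feasible SΩ) := by
  rintro ⟨q, y⟩ ⟨hq, hy, hM⟩ ⟨q', y'⟩ ⟨hq', hy', hM'⟩ a b ha hb hab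
  refine ⟨hconv hq hq' ha hb hab, ?_, ?_⟩
  · simp only [Prod.snd_add, Prod.smul_snd, Pi.add_apply, Pi.smul_apply, smul_eq_mul] at hy hy' ⊢
    rw [hy, hy', mul_one, mul_one, hab]
  · simp only [Prod.snd_add, Prod.smul_snd, momentMatrix_add_smul]
    exact (hM.smul ha).add (hM'.smul hb)

lemma objective_convex [Fintype C] (hα : 1 < α) {SΩ : Set (Option C → ℝ)} (hq : 0 ≤ qMin SΩ)
    (u v : (Option C → ℝ) × (R.words → ℝ)) {a b : ℝ} (ha : 0 < a) (hb : 0 < b) (hab : a + b = 1) :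
    R.objective SΩ (a • u + b • v) ≤
      (a : EReal) * R.objective SΩ u + (b : EReal) * R.objective SΩ v := by
  have hcoeff : qMin SΩ / (1 - α) ≤ 0 := div_nonpos_of_nonneg_of_nonpos hq (by linarith)
  have hscale : 0 ≤ 1 / (α - 1) := one_div_nonneg.2 (by linarith)
  have hf : R.f (a • u + b • v).2 = a • R.f u.2 + b • R.f v.2 :=
    funext fun c => R.lin_add_smul _ a b u.2 v.2
  have hg : R.g (a • u + b • v).2 = a * R.g u.2 + b * R.g v.2 := R.lin_add_smul _ a b u.2 v.2
  have hdivergence := mul_le_mul_of_nonneg_left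
    (relEntropy_convex u.1 v.1 (R.f u.2) (R.f v.2) ha hb) (EReal.coe_nonneg.2 hscale)
  have hlog := coe_mul_elogTwo_convex hcoeff (R.g u.2) (R.g v.2) ha hb hab
  rw [objective, hf, hg]
  refine (add_le_add hdivergence hlog).trans_eq ?_
  rw [objective, objective, ereal_coe_mul_add ha.le, ereal_coe_mul_add hb.le,
    ereal_coe_mul_add hscale, add_add_add_comm, mul_left_comm _ (a : EReal),
    mul_left_comm _ (b : EReal)]

theorem isConvexProgram [Fintype C] (hα : 1 < α) {SΩ : Set (Option C → ℝ)}
    (hq : 0 ≤ qMin SΩ) (hconv : Convex ℝ SΩ) :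
    IsConvexProgram (R.feasible SΩ) (R.objective SΩ) :=
  ⟨R.convex_feasible hconv, fun u _ v _ _ _ ha hb hab => R.objective_convex hα hq u v ha hb hab⟩

end NPARelaxation

end Convexity

theorem theorem7 {X Y A B C : Type*} [Fintype X] [DecidableEq X] [Fintype Y] [DecidableEq Y]
    [Fintype A] [DecidableEq A] [Fintype C] [DecidableEq C]
    (P : Protocol X Y A B C) (SΩ : Set (Option C → ℝ)) (hSΩ : SΩ ⊆ stdSimplex ℝ (Option C))
    (α : ℝ) (hα : α ∈ Set.Ioo (1 : ℝ) 2) (m : ℕ) (hm : 1 ≤ m) :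
    (∃ t w : Fin m → ℝ, IsGaussRadauJacobi α t w) ∧
    ∀ t w : Fin m → ℝ, IsGaussRadauJacobi α t w →
      (∀ i, t i ∈ Set.Ioc (0 : ℝ) 1 ∧ 0 < w i) ∧
      ∀ R : NPARelaxation P α t w,
        R.value SΩ ≤ P.roundValue α SΩ ∧
        (Convex ℝ SΩ → IsConvexProgram (R.feasible SΩ) (R.objective SΩ)) := by
  exact ⟨exists_isGaussRadauJacobi hα hm, fun t w h =>
    ⟨fun i => ⟨h.node_mem_Ioc hα i, h.weight_pos hα i⟩, fun R =>
      ⟨Protocol.value_le_roundValue hα hm h R (qMin_nonneg hSΩ),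
        R.isConvexProgram hα.1 (qMin_nonneg hSΩ)⟩⟩⟩
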